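/- **Setting.** Let $(S,d)$ be a complete metric space and $\sigma$ a Hausdorff topology on $S$, weaker than the topology induced by $d$, such that $d$ is $\sigma$-lower semicontinuous on $S\times S$. For every $\tau>0$ let $(a^\tau_n)_{n\ge 1}$ be a sequence of positive numbers, and put $a^\tau(t)=a^\tau_{\lceil t/\tau\rceil}$ for $t>0$. For every $\varepsilon>0$ let $\phi_\varepsilon:S\to(-\infty,+\infty]$ be a proper functional, and let $\phi:S\to(-\infty,+\infty]$. Initial data $u_0^{\tau,\varepsilon}\in S$, $\tau,\varepsilon>0$, are given. A *discrete solution* for $(\tau,\varepsilon)$ is a sequence $(u^{\tau,\varepsilon}_n)_{n\ge0}$ that starts from $u_0^{\tau,\varepsilon}$, which must satisfy $\phi_\varepsilon(u_0^{\tau,\varepsilon})<+\infty$, and is such that for all $n\ge1$ $$u_n^{\tau,\varepsilon}\in\operatorname*{argmin}_{v\in S}\Big\{\phi_\varepsilon(v)+a_n^\tau\frac{d^2(v,u_{n-1}^{\tau,\varepsilon})}{2\tau}\Big\};$$ it is identified with the curve $u^{\tau,\varepsilon}(t)=u^{\tau,\varepsilon}_{\lceil t/\tau\rceil}$, $t\ge0$.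 A curve $u:[0,+\infty)\to S$ is an *$\{a^\tau\}$-perturbed minimizing movement along $\{\phi_\varepsilon\}$* if there are positive sequences $\tau_k\to0$, $\varepsilon_k\to0$ and discrete solutions $u^{\tau_k,\varepsilon_k}$ such that $u^{\tau_k,\varepsilon_k}(t)\to u(t)$ in $\sigma$ for every $t\ge0$. The *local slope* of a functional $\psi:S\to(-\infty,+\infty]$ is $|\partial\psi|(u)=\limsup_{v\to u}\frac{(\psi(u)-\psi(v))_+}{d(u,v)}$ (limit in $d$; value $0$ at isolated points) if $\psi(u)<+\infty$, and $+\infty$ otherwise. A curve $v$ is in $AC(a,b;S)$ if there is $m\in L^1(a,b)$ with $d(v(s),v(t))\le\int_s^t m$ for $a<s\le t<b$; its metric derivative is $|v'|(t)=\lim_{s\to t}d(v(s),v(t))/|s-t|$, which exists for a.e. $t$. A function $g:S\to[0,+\infty]$ is a *strong upper gradient* for $\phi$ if for every $v\in AC(a,b;S)$ the function $g\circ v$ is Borel on $(a,b)$ and $|\phi(v(t))-\phi(v(s))|\le\int_s^t g(v(\xi))|v'|(\xi)\,d\xi$ for all $a<s<t<b$ (with $|\infty-\infty|=0$). Let $g$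 be a strong upper gradient for $\phi$ and $\lambda:(0,+\infty)\to(0,+\infty)$ measurable. A curve $u$ is a *curve of maximal slope for $\phi$ with respect to $g$ of rate $\lambda$* on $(0,+\infty)$ if $u\in AC(0,T;S)$ for every $T>0$ and $\phi\circ u$ equals almost everywhere in $(0,+\infty)$ a non-increasing function $\psi:(0,+\infty)\to\mathbb R$ such that for all $0<s<t$ $$\psi(t)-\psi(s)\le-\frac12\int_s^t\frac1{\lambda(\xi)}|u'|^2(\xi)\,d\xi-\frac12\int_s^t\lambda(\xi)\,g(u(\xi))^2\,d\xi .$$ **Theorem.** Assume that there is $u^*\in S$ such that 1. $\phi_\varepsilon$ is $\sigma$-lower semicontinuous for every $\varepsilon>0$; 2. $\inf_{u\in S,\,\varepsilon>0}\{\phi_\varepsilon(u)+c\,d^2(u,u^*)\}>-\infty$ for every $c>0$; 3. for every $c>0$ there is a set $K_c\subseteq S$, compact in the topology $\sigma$, with $\bigcup_{\varepsilon>0}\{u\in S: d(u,u^*)<c,\ \phi_\varepsilon(u)<c\}\subseteq K_c$; 4. there is a constant $C_0$ such that $d(u_0^{\tau,\varepsilon},u^*)\le C_0$ and $\phi_\varepsilon(u_0^{\tau,\varepsilon})\le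 C_0$ for all $\tau,\varepsilon>0$; 5. the family $\{1/a^\tau\}_{\tau>0}$ is uniformly integrable on $[0,T]$ for every $T>0$. Assume that $1/a^\tau\rightharpoonup1/a^*$ weakly in $L^1_{\rm loc}(0,+\infty)$ as $\tau\to0^+$ for some measurable $a^*:(0,+\infty)\to(0,+\infty)$ (in particular $a^*$ is finite). Assume moreover that * (i) $\phi_\varepsilon$ converges to $\phi$ according to the conditions of Colombo–Gobbino: whenever $\varepsilon_k\to0^+$, $v_k\to v$ in $\sigma$ and $\sup_k\{|\phi_{\varepsilon_k}(v_k)|,\ |\partial\phi_{\varepsilon_k}|(v_k)\}<+\infty$, one has $\lim_k\phi_{\varepsilon_k}(v_k)=\phi(v)$ and $\liminf_k|\partial\phi_{\varepsilon_k}|(v_k)\ge|\partial\phi|(v)$; * (ii) the local slope $|\partial\phi|$ is a strong upper gradient for $\phi$. Then every $\{a^\tau\}$-perturbed minimizing movement along $\{\phi_\varepsilon\}$ is a curve of maximal slope for $\phi$ with respect to $|\partial\phi|$ of rate $1/a^*$. -/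

import Mathlib

open Set Filter Topology MeasureTheory
open scoped ENNReal

noncomputable section

namespace PerturbedMM

/-- The family of perturbations is `a τ n` (`τ > 0`, `n ≥ 1`); this is the piecewise-constant
interpolation `a^τ(t) = a^τ_{⌈t/τ⌉}`. -/
def interp (a : ℝ → ℕ → ℝ) (τ t : ℝ) : ℝ := a τ ⌈t / τ⌉₊

section Metric

variable {S : Type*} [MetricSpace S]

/-- The local slope `|∂φ|(u) = limsup_{v → u} (φ(u) - φ(v))₊ / d(u, v)` for `u` in the domain
of `φ` (so `0` at isolated points of `S`), and `+∞` outside the domain. -/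
def localSlope (φ : S → EReal) (u : S) : ℝ≥0∞ :=
  open Classical in
  if φ u = ⊤ then ⊤
  else limsup (fun v => (φ u - φ v).toENNReal / edist u v) (𝓝[≠] u)

/-- The metric derivative `|v'|(t) = lim_{s → t} d(v(t), v(s)) / |t - s|`, written with a `limsup`
so that it is defined for every `t`. -/
def metricDeriv (v : ℝ → S) (t : ℝ) : ℝ≥0∞ :=
  limsup (fun s => edist (v t) (v s) / ENNReal.ofReal |t - s|) (𝓝[≠] t)

/-- `v ∈ AC(a, b; S)`. -/
def IsAC (v : ℝ → S) (a b : ℝ) : Prop :=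
  ∃ m : ℝ → ℝ, IntegrableOn m (Ioo a b) ∧
    ∀ s t, a < s → s ≤ t → t < b → dist (v s) (v t) ≤ ∫ r in s..t, m r

/-- `g` is a strong upper gradient for `φ`. The estimate `|φ(v(t)) - φ(v(s))| ≤ ∫ g(v) |v'|` is
written as two inequalities in `(-∞, +∞]`, so that it also makes sense where `φ ∘ v` is `+∞`. -/
def IsStrongUpperGradient (φ : S → EReal) (g : S → ℝ≥0∞) : Prop :=
  ∀ (a b : ℝ) (v : ℝ → S), IsAC v a b →
    Measurable ((Ioo a b).domRestrict (fun t => g (v t))) ∧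
    ∀ s t, a < s → s < t → t < b →
      φ (v t) ≤ φ (v s) + ((∫⁻ r in Ioo s t, g (v r) * metricDeriv v r : ℝ≥0∞) : EReal) ∧
      φ (v s) ≤ φ (v t) + ((∫⁻ r in Ioo s t, g (v r) * metricDeriv v r : ℝ≥0∞) : EReal)

/-- `u`, restricted to `(0, +∞)`, is a curve of maximal slope for `φ` with respect to the strong
upper gradient `g`, of rate `rate : (0, +∞) → (0, +∞)`. Here `ψ` is the non-increasing
representative of `φ ∘ u`. -/
structure IsCurveOfMaximalSlope (φ : S → EReal) (g : S → ℝ≥0∞) (rate : ℝ → ℝ)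
    (u : ℝ → S) : Prop where
  upperGradient : IsStrongUpperGradient φ g
  rate_measurable : Measurable rate
  rate_pos : ∀ t, 0 < t → 0 < rate t
  ac : ∀ T, 0 < T → IsAC u 0 T
  energy : ∃ ψ : ℝ → ℝ, AntitoneOn ψ (Ioi 0) ∧
    (∀ᵐ t ∂(volume.restrict (Ioi (0 : ℝ))), φ (u t) = (ψ t : EReal)) ∧
    ∀ s t, 0 < s → s < t →
      (1 / 2) * (∫⁻ r in Ioo s t, ENNReal.ofReal (1 / rate r) * metricDeriv u r ^ 2) +
        (1 / 2) * (∫⁻ r in Ioo s t, ENNReal.ofReal (rate r) * g (u r) ^ 2)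
        ≤ ENNReal.ofReal (ψ s - ψ t)

/-- `w` is a discrete solution of the perturbed Euler scheme for the functional `φ`, with step `τ`,
coefficients `a 1, a 2, …` and initial datum `x₀`. -/
structure IsDiscreteSolution (φ : S → EReal) (τ : ℝ) (a : ℕ → ℝ) (x₀ : S) (w : ℕ → S) :
    Prop where
  init : w 0 = x₀
  init_dom : φ (w 0) ≠ ⊤
  step : ∀ n, ∀ v, φ (w (n + 1)) +
      ((a (n + 1) * (dist (w (n + 1)) (w n) ^ 2 / (2 * τ)) : ℝ) : EReal) ≤
    φ v + ((a (n + 1) * (dist v (w n) ^ 2 / (2 * τ)) : ℝ) : EReal)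

/-- `u : [0, +∞) → S` is an `{a^τ}`-perturbed minimizing movement along `{φ_ε}`, with initial data
`u₀ τ ε`, limits of discrete solutions being taken in the topology `σ`. Only the values of `u` on
`[0, +∞)` matter. -/
def IsPerturbedMinimizingMovement (σ : TopologicalSpace S) (φ : ℝ → S → EReal)
    (a : ℝ → ℕ → ℝ) (u₀ : ℝ → ℝ → S) (u : ℝ → S) : Prop :=
  ∃ (τ ε : ℕ → ℝ) (w : ℕ → ℕ → S),
    (∀ k, 0 < τ k) ∧ (∀ k, 0 < ε k) ∧ Tendsto τ atTop (𝓝 0) ∧ Tendsto ε atTop (𝓝 0) ∧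
    (∀ k, IsDiscreteSolution (φ (ε k)) (τ k) (a (τ k)) (u₀ (τ k) (ε k)) (w k)) ∧
    ∀ t, 0 ≤ t → Tendsto (fun k => w k ⌈t / τ k⌉₊) atTop (@nhds S σ (u t))

/-- The five conditions: lower semicontinuity, equicoerciveness, equicompactness, control of the
initial data, local uniform integrability of the reciprocals of the perturbations. -/
structure ExistenceAssumptions (σ : TopologicalSpace S) (φ : ℝ → S → EReal)
    (a : ℝ → ℕ → ℝ) (u₀ : ℝ → ℝ → S) (ustar : S) : Prop where
  lsc : ∀ ε, 0 < ε → @LowerSemicontinuous S EReal σ _ (φ ε)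
  coercive : ∀ c : ℝ, 0 < c → ∃ B : ℝ, ∀ ε, 0 < ε → ∀ u,
    (B : EReal) ≤ φ ε u + ((c * dist u ustar ^ 2 : ℝ) : EReal)
  compact : ∀ c : ℝ, 0 < c → ∃ K : Set S, @IsCompact S σ K ∧
    ∀ ε, 0 < ε → ∀ u, dist u ustar < c → φ ε u < (c : EReal) → u ∈ K
  initial : ∃ C₀ : ℝ, ∀ τ ε, 0 < τ → 0 < ε →
    dist (u₀ τ ε) ustar ≤ C₀ ∧ φ ε (u₀ τ ε) ≤ (C₀ : EReal)
  unifIntegrable : ∀ T : ℝ, 0 < T →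
    UniformIntegrable (fun (τ : {τ : ℝ // 0 < τ}) (t : ℝ) => 1 / interp a τ t) 1
      (volume.restrict (Icc 0 T))

/-- Convergence of `φ_ε` to `φ` according to the conditions of Colombo–Gobbino. -/
def ColomboGobbino (σ : TopologicalSpace S) (φ : ℝ → S → EReal) (φlim : S → EReal) : Prop :=
  ∀ (ε : ℕ → ℝ) (v : ℕ → S) (vlim : S),
    (∀ k, 0 < ε k) → Tendsto ε atTop (𝓝 0) → Tendsto v atTop (@nhds S σ vlim) →
    (∃ C : ℝ, ∀ k, ((-C : ℝ) : EReal) ≤ φ (ε k) (v k) ∧ φ (ε k) (v k) ≤ (C : EReal) ∧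
      localSlope (φ (ε k)) (v k) ≤ ENNReal.ofReal C) →
    Tendsto (fun k => φ (ε k) (v k)) atTop (𝓝 (φlim vlim)) ∧
    localSlope φlim vlim ≤ liminf (fun k => localSlope (φ (ε k)) (v k)) atTop

end Metric

/-- Weak convergence `f τ ⇀ f₀` in `L¹_loc(0, +∞)` as `τ → 0⁺`: on every compact interval
`[s, t] ⊆ (0, +∞)` the functions are integrable, and the integrals against every bounded measurable
function converge. -/
def WeakL1LocConverges (f : ℝ → ℝ → ℝ) (f₀ : ℝ → ℝ) : Prop :=
  ∀ s t : ℝ, 0 < s → s < t →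
    (∀ τ, 0 < τ → IntegrableOn (f τ) (Icc s t)) ∧ IntegrableOn f₀ (Icc s t) ∧
    ∀ g : ℝ → ℝ, Measurable g → (∃ C : ℝ, ∀ x, |g x| ≤ C) →
      Tendsto (fun τ => ∫ r in Icc s t, g r * f τ r) (𝓝[>] 0) (𝓝 (∫ r in Icc s t, g r * f₀ r))

end PerturbedMM

end

/-!
The limit curve inherits a sharp energy inequality from De Giorgi's variational interpolation of the
discrete solutions.

On one step of length `τ` with coefficient `a`, starting from `x`, the interpolant at elapsed time
`θ` minimizes `φ(v) + a d²(v, x) / (2 θ)`. Its slope is at most `a d / θ`, and differentiating the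
minimum value in `θ` shows that the energy lost in the step is at least the kinetic energy of the
step plus half the integral of `(1 / a) (a d / θ)²`
(`IsVariationalInterpolant.lintegral_slope_le`). Summing over the steps and using the Cauchy-Schwarz
inequality on the kinetic part gives, for a discrete solution with energies `F` and slope bound `H`,
`d²(w m, w N) ≤ (2 (F m - F N) - ∫ (1 / a) H²) ∫ 1 / a`
(`IsInterpolation.energy_inequality`). Coercivity makes the discrete solutions and their energies
bounded (`IsDiscreteSolution.bounds`), so that along a subsequence the energies converge at all
rational times; `ψ` is the upper limit of the energies.

In the limit `1 / a` becomes `l = 1 / a*`, the distance is lower semicontinuous, and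
`∫ l liminf H² ≤ liminf ∫ (1 / a) H²` (`lintegral_mul_liminf_le`). Hence
`d²(u s, u t) ≤ 2 (k t - k s) ∫ l` over `(s, t)`, where
`k = -ψ - (1 / 2) ∫ l liminf H²` is monotone (`ConvergentScheme.energy_inequality`). Such a bound
forces `u` to be absolutely continuous and, on differentiating, `|u'|² ≤ 2 k' l` almost everywhere;
since the integral of `k'` is at most the increment of `k`, the kinetic energy
`(1 / 2) ∫ |u'|² / l` is at most `ψ s - ψ t - (1 / 2) ∫ l liminf H²`
(`ConvergentScheme.dissipation_le`).

It remains to identify the limits at a fixed time (`ConvergentScheme.limit_at`). The interpolants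
converge to `u t` because they stay in a compact set and close to the discrete solution. Where
`liminf H` is finite, which is almost everywhere because `l > 0`, the Colombo-Gobbino conditions
apply along a subsequence realizing this lower limit: `liminf H` bounds the slope of `φ` at `u t`,
and `φ (u t)` is the limit of energies that lie between the values of `ψ` at earlier and later
times, so that `φ ∘ u = ψ` at the continuity points of `ψ`.
-/

namespace PerturbedMM

/-! ### Monotone functions and absolute continuity -/

/-- A function dominated almost everywhere by the derivative of a monotone function has integral
at most the increment of that function. -/
theorem lintegral_le_of_le_deriv_monotoneOn {k : ℝ → ℝ} {s t : ℝ} (hst : s ≤ t)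
    (hk : MonotoneOn k (Icc s t)) {f : ℝ → ℝ≥0∞}
    (hf : ∀ᵐ r, r ∈ Ioo s t → ∀ c, HasDerivAt k c r → f r ≤ ENNReal.ofReal c) :
    ∫⁻ r in Ioo s t, f r ≤ ENNReal.ofReal (k t - k s) := by
  have hk' : MonotoneOn k (uIcc s t) := by rwa [uIcc_of_le hst]
  have hint : IntegrableOn (deriv k) (Ioo s t) :=
    ((intervalIntegrable_iff_integrableOn_Ioc_of_le hst).1
      hk'.intervalIntegrable_deriv).mono_set Ioo_subset_Ioc_self
  have hmem := hk'.intervalIntegral_deriv_mem_uIcc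
  have hle : k s ≤ k t := hk (left_mem_Icc.2 hst) (right_mem_Icc.2 hst) hst
  rw [uIcc_of_le (by linarith), intervalIntegral.integral_of_le hst,
    integral_Ioc_eq_integral_Ioo] at hmem
  have hnn : 0 ≤ᵐ[volume.restrict (Ioo s t)] deriv k := by
    refine (ae_restrict_iff' measurableSet_Ioo).2 (Eventually.of_forall fun r hr => ?_)
    rw [Pi.zero_apply, ← derivWithin_of_mem_nhds (Icc_mem_nhds hr.1 hr.2)]
    exact hk.derivWithin_nonneg
  calc ∫⁻ r in Ioo s t, f r ≤ ∫⁻ r in Ioo s t, ENNReal.ofReal (deriv k r) := by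
        refine lintegral_mono_ae ((ae_restrict_iff' measurableSet_Ioo).2 ?_)
        filter_upwards [hf, hk.ae_differentiableWithinAt_of_mem] with r hr hd hrm
        exact hr hrm _ ((hd (Ioo_subset_Icc_self hrm)).differentiableAt
          (Icc_mem_nhds hrm.1 hrm.2)).hasDerivAt
    _ = ENNReal.ofReal (∫ r in Ioo s t, deriv k r) :=
        (ofReal_integral_eq_lintegral_ofReal hint hnn).symm
    _ ≤ _ := ENNReal.ofReal_le_ofReal hmem.2

/-- The increments of a monotone function over disjoint intervals add up to at most its total
increment. -/
theorem sum_increments_le_of_monotoneOn {k : ℝ → ℝ} {a b : ℝ} (hk : MonotoneOn k (Icc a b))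
    {x y : ℕ → ℝ} (F : Finset ℕ) (hF : ∀ i ∈ F, a ≤ x i ∧ x i < y i)
    (hd : (F : Set ℕ).PairwiseDisjoint fun i => Ioc (x i) (y i)) :
    ∀ t ∈ Icc a b, (∀ i ∈ F, y i ≤ t) → ∑ i ∈ F, (k (y i) - k (x i)) ≤ k t - k a := by
  -- Induction on the number of intervals, the rightmost one being removed at each stage.
  induction F using Finset.induction_on_max_value y with
  | empty =>
    intro t ht _
    simpa using hk (left_mem_Icc.2 (ht.1.trans ht.2)) ht ht.1
  | insert i s his hmax ih =>
    intro t ht hyt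
    rw [Finset.sum_insert his]
    have hi := hF i (Finset.mem_insert_self _ _)
    have hit := hyt i (Finset.mem_insert_self _ _)
    have h1 := ih (fun j hj => hF j (Finset.mem_insert_of_mem hj))
      (hd.subset (by simp)) (x i) ⟨hi.1, by linarith [ht.2]⟩ (fun j hj => by
        by_contra! hlt
        have hj' := hF j (Finset.mem_insert_of_mem hj)
        have hij : i ≠ j := fun h => his (h ▸ hj)
        have := hd (Finset.mem_coe.2 (Finset.mem_insert_self _ _))
          (Finset.mem_coe.2 (Finset.mem_insert_of_mem hj)) hij
        exact Set.disjoint_left.1 this ⟨hlt, hmax j hj⟩ ⟨hj'.2, le_rfl⟩)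
    have h2 := hk ⟨by linarith, by linarith [ht.2]⟩ ht hit
    linarith

/-- If the squared increments of `f` are controlled by the product of the increments of a monotone
function and of an absolutely continuous one, then `f` is absolutely continuous. -/
theorem absolutelyContinuousOnInterval_of_dist_sq_le {f k L : ℝ → ℝ} {a b : ℝ} (hab : a ≤ b)
    (hk : MonotoneOn k (Icc a b)) (hL : AbsolutelyContinuousOnInterval L a b)
    (hf : ∀ r ∈ Icc a b, ∀ r' ∈ Icc a b, r ≤ r' →
      dist (f r) (f r') ^ 2 ≤ 2 * (k r' - k r) * (L r' - L r)) :
    AbsolutelyContinuousOnInterval f a b := by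
  rw [absolutelyContinuousOnInterval_iff] at hL ⊢
  intro ε hε
  have hK : k a ≤ k b := hk (left_mem_Icc.2 hab) (right_mem_Icc.2 hab) hab
  obtain ⟨η, hη, hηK⟩ : ∃ η > 0, η * (k b - k a) < ε / 2 := by
    refine ⟨ε / (2 * (k b - k a + 1)), by apply div_pos hε; linarith, ?_⟩
    rw [div_mul_eq_mul_div, div_lt_div_iff₀ (by linarith) (by norm_num)]
    nlinarith
  obtain ⟨δ, hδ, H⟩ := hL (η * ε) (by positivity)
  refine ⟨δ, hδ, fun E hE hlen => ?_⟩
  have hsum := H E hE hlen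
  obtain ⟨hmem, hdisj⟩ := hE
  rw [uIcc_of_le hab] at hmem
  -- Young's inequality: the square root of `2 Δk ΔL` is at most `η Δk + ΔL / (2 η)`.
  have key : ∀ i ∈ Finset.range E.1, dist (f (E.2 i).1) (f (E.2 i).2) ≤
      η * (k (max (E.2 i).1 (E.2 i).2) - k (min (E.2 i).1 (E.2 i).2)) +
        dist (L (E.2 i).1) (L (E.2 i).2) / (2 * η) := by
    intro i hi
    obtain ⟨h1, h2⟩ := hmem i hi
    have main : ∀ r ∈ Icc a b, ∀ r' ∈ Icc a b, r ≤ r' →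
        dist (f r) (f r') ≤ η * (k r' - k r) + dist (L r) (L r') / (2 * η) := by
      intro r hr r' hr' hrr
      have hA : 0 ≤ k r' - k r := sub_nonneg.2 (hk hr hr' hrr)
      have hB : L r' - L r ≤ dist (L r) (L r') := by
        rw [dist_comm]; exact le_abs_self _
      have hC : 0 ≤ dist (L r) (L r') := dist_nonneg
      refine abs_le_of_sq_le_sq' ?_ (by positivity) |>.2
      have e : (η * (k r' - k r) + dist (L r) (L r') / (2 * η)) ^ 2 =
          (η * (k r' - k r) - dist (L r) (L r') / (2 * η)) ^ 2 +
            2 * (k r' - k r) * dist (L r) (L r') := by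
        field_simp; ring
      rw [e]
      have := mul_le_mul_of_nonneg_left hB (by positivity : 0 ≤ 2 * (k r' - k r))
      nlinarith [hf r hr r' hr' hrr, sq_nonneg (η * (k r' - k r) - dist (L r) (L r') / (2 * η))]
    rcases le_total (E.2 i).1 (E.2 i).2 with h | h
    · rw [max_eq_right h, min_eq_left h]; exact main _ h1 _ h2 h
    · rw [max_eq_left h, min_eq_right h, dist_comm, dist_comm (L _)]; exact main _ h2 _ h1 h
  have hmono : ∑ i ∈ Finset.range E.1,
      (k (max (E.2 i).1 (E.2 i).2) - k (min (E.2 i).1 (E.2 i).2)) ≤ k b - k a := by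
    have hfil : ∑ i ∈ Finset.range E.1,
        (k (max (E.2 i).1 (E.2 i).2) - k (min (E.2 i).1 (E.2 i).2)) =
        ∑ i ∈ (Finset.range E.1).filter (fun i => (E.2 i).1 ≠ (E.2 i).2),
        (k (max (E.2 i).1 (E.2 i).2) - k (min (E.2 i).1 (E.2 i).2)) := by
      symm
      refine Finset.sum_filter_of_ne fun i _ hne h => hne ?_
      simp [h]
    rw [hfil]
    refine sum_increments_le_of_monotoneOn hk (x := fun i => min (E.2 i).1 (E.2 i).2)
      (y := fun i => max (E.2 i).1 (E.2 i).2) _ (fun i hi => ?_) ?_ b (right_mem_Icc.2 hab)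
      (fun i hi => ?_)
    · rw [Finset.mem_filter] at hi
      exact ⟨le_min (hmem i hi.1).1.1 (hmem i hi.1).2.1, min_lt_max.2 hi.2⟩
    · exact hdisj.subset (Finset.coe_subset.2 (Finset.filter_subset _ _))
    · rw [Finset.mem_filter] at hi
      exact max_le (hmem i hi.1).1.2 (hmem i hi.1).2.2
  calc _ ≤ ∑ i ∈ Finset.range E.1,
        (η * (k (max (E.2 i).1 (E.2 i).2) - k (min (E.2 i).1 (E.2 i).2)) +
        dist (L (E.2 i).1) (L (E.2 i).2) / (2 * η)) := Finset.sum_le_sum key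
    _ = η * ∑ i ∈ Finset.range E.1,
          (k (max (E.2 i).1 (E.2 i).2) - k (min (E.2 i).1 (E.2 i).2)) +
        (∑ i ∈ Finset.range E.1, dist (L (E.2 i).1) (L (E.2 i).2)) / (2 * η) := by
      rw [Finset.sum_add_distrib, Finset.mul_sum, Finset.sum_div]
    _ < ε := by
      have h1 := mul_le_mul_of_nonneg_left hmono hη.le
      have h2 : (∑ i ∈ Finset.range E.1, dist (L (E.2 i).1) (L (E.2 i).2)) / (2 * η) <
          ε / 2 := by
        rw [div_lt_div_iff₀ (by positivity) (by norm_num)]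
        linarith
      linarith

/-! ### Curves whose squared increments are controlled -/

section Curves

variable {S : Type*} [MetricSpace S]

/-- A density for the length of `u`: Young's inequality bounds the increments of `u` by those of
`k + L / 2`, where `L` is the primitive of `l`. Although `k` may jump, the derivative of `k` is
enough, because the distance from `u s` is absolutely continuous. -/
theorem dist_le_integral_of_dist_sq_le {u : ℝ → S} {k l : ℝ → ℝ} {s t : ℝ} (hst : s ≤ t)
    (hk : MonotoneOn k (Icc s t)) (hl : IntervalIntegrable l volume s t)
    (hlpos : ∀ r ∈ Icc s t, 0 ≤ l r)
    (hu : ∀ r ∈ Icc s t, ∀ r' ∈ Icc s t, r ≤ r' →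
      dist (u r) (u r') ^ 2 ≤ 2 * (k r' - k r) * ∫ x in r..r', l x) :
    dist (u s) (u t) ≤ ∫ r in s..t, (deriv k r + l r / 2) := by
  set L : ℝ → ℝ := fun r => ∫ x in s..r, l x with hLdef
  have hsub : ∀ r ∈ Icc s t, IntervalIntegrable l volume s r := fun r hr =>
    hl.mono_set (by rw [uIcc_of_le hst, uIcc_of_le hr.1]; exact Icc_subset_Icc_right hr.2)
  have hLsub : ∀ r ∈ Icc s t, ∀ r' ∈ Icc s t, ∫ x in r..r', l x = L r' - L r := by
    intro r hr r' hr'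
    exact (intervalIntegral.integral_interval_sub_left (hsub r' hr') (hsub r hr)).symm
  have hk' : MonotoneOn k (uIcc s t) := by rwa [uIcc_of_le hst]
  have hL : AbsolutelyContinuousOnInterval L s t :=
    hl.absolutelyContinuousOnInterval_intervalIntegral (by simp)
  set f : ℝ → ℝ := fun r => dist (u s) (u r) with hfdef
  have hfu : ∀ r r', dist (f r) (f r') ≤ dist (u r) (u r') := fun r r' => by
    rw [hfdef, dist_comm (u r)]
    simpa [dist_comm, Real.dist_eq] using abs_dist_sub_le (u r) (u r') (u s)
  have hfac : AbsolutelyContinuousOnInterval f s t := by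
    refine absolutelyContinuousOnInterval_of_dist_sq_le hst hk hL fun r hr r' hr' hrr => ?_
    rw [← hLsub r hr r' hr']
    exact (pow_le_pow_left₀ dist_nonneg (hfu r r') 2).trans (hu r hr r' hr' hrr)
  have hint : f t - f s = ∫ r in s..t, deriv f r := hfac.integral_deriv_eq_sub.symm
  have hft : dist (u s) (u t) = ∫ r in s..t, deriv f r := by
    rw [← hint]; simp [hfdef]
  rw [hft]
  rw [intervalIntegral.integral_of_le hst, intervalIntegral.integral_of_le hst]
  refine setIntegral_mono_ae_restrict
    ((intervalIntegrable_iff_integrableOn_Ioc_of_le hst).1 hfac.intervalIntegrable_deriv)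
    ((intervalIntegrable_iff_integrableOn_Ioc_of_le hst).1
      (hk'.intervalIntegrable_deriv.add (hl.div_const 2))) ?_
  -- `k + L / 2 - f` is monotone, hence its derivative is nonnegative wherever it exists.
  have hmono : MonotoneOn (fun r => k r + L r / 2 - f r) (Icc s t) := by
    intro r hr r' hr' hrr
    have h0 := hfu r r'
    have h1 : f r' - f r ≤ dist (f r) (f r') := by
      rw [dist_comm]; exact le_abs_self _
    have h2 := hu r hr r' hr' hrr
    rw [hLsub r hr r' hr'] at h2
    have h3 := hk hr hr' hrr
    have h4 : 0 ≤ dist (u r) (u r') := dist_nonneg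
    have h5 : dist (u r) (u r') ≤ |(k r' - k r) + (L r' - L r) / 2| := by
      refine abs_le_of_sq_le_sq' ?_ (abs_nonneg _) |>.2
      rw [sq_abs]
      nlinarith [sq_nonneg ((k r' - k r) - (L r' - L r) / 2)]
    have h6 : 0 ≤ L r' - L r := by
      rw [← hLsub r hr r' hr']
      exact intervalIntegral.integral_nonneg hrr
        fun x hx => hlpos x ⟨hr.1.trans hx.1, hx.2.trans hr'.2⟩
    dsimp only
    rw [abs_of_nonneg (by linarith)] at h5
    linarith
  rw [EventuallyLE, ← restrict_Ioo_eq_restrict_Ioc, ae_restrict_iff' measurableSet_Ioo]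
  filter_upwards [hfac.ae_differentiableAt, hl.ae_hasDerivAt_integral,
    hk.ae_differentiableWithinAt_of_mem] with r h1 h2 h3 hr
  have hrI := Ioo_subset_Icc_self hr
  have hnhds := Icc_mem_nhds hr.1 hr.2
  have d1 := (h1 (by rwa [uIcc_of_le hst])).hasDerivAt
  have d2 : HasDerivAt L (l r) r := h2 (by rwa [uIcc_of_le hst]) s (by simp)
  have d3 := ((h3 hrI).differentiableAt hnhds).hasDerivAt
  have d4 := (d3.add (d2.div_const 2)).sub d1
  have := hmono.derivWithin_nonneg (x := r)
  rw [derivWithin_of_mem_nhds hnhds] at this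
  have e := d4.deriv
  change deriv (fun r => k r + L r / 2 - f r) r = _ at e
  linarith

theorem metricDeriv_sq_le {u : ℝ → S} {k L : ℝ → ℝ} {r c l : ℝ} (hk : HasDerivAt k c r)
    (hL : HasDerivAt L l r)
    (hu : ∀ᶠ x in 𝓝 r, dist (u r) (u x) ^ 2 ≤ 2 * (k x - k r) * (L x - L r)) :
    metricDeriv u r ^ 2 ≤ ENNReal.ofReal (2 * c * l) := by
  have hlim : Tendsto (fun x => ENNReal.ofReal √(2 * slope k r x * slope L r x)) (𝓝[≠] r)
      (𝓝 (ENNReal.ofReal √(2 * c * l))) := by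
    refine ENNReal.tendsto_ofReal (Tendsto.sqrt ?_)
    exact (tendsto_const_nhds.mul (hasDerivAt_iff_tendsto_slope.1 hk)).mul
      (hasDerivAt_iff_tendsto_slope.1 hL)
  have hle : metricDeriv u r ≤ ENNReal.ofReal √(2 * c * l) := by
    rw [← hlim.limsup_eq]
    refine limsup_le_limsup ?_
    filter_upwards [hu.filter_mono nhdsWithin_le_nhds, self_mem_nhdsWithin] with x hx hne
    have hpos : 0 < |r - x| := abs_pos.2 (sub_ne_zero.2 (Ne.symm hne))
    rw [edist_dist, ← ENNReal.ofReal_div_of_pos hpos]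
    refine ENNReal.ofReal_le_ofReal (Real.le_sqrt_of_sq_le ?_)
    rw [div_pow, sq_abs, div_le_iff₀ (by rw [← sq_abs]; positivity), slope_def_field,
      slope_def_field]
    have hne' : x - r ≠ 0 := sub_ne_zero.2 hne
    calc _ ≤ _ := hx
      _ = _ := by field_simp; ring
  calc metricDeriv u r ^ 2 ≤ ENNReal.ofReal √(2 * c * l) ^ 2 := by gcongr
    _ = ENNReal.ofReal (√(2 * c * l) ^ 2) := (ENNReal.ofReal_pow (Real.sqrt_nonneg _) 2).symm
    _ ≤ _ := by
      rcases le_total 0 (2 * c * l) with h | h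
      · rw [Real.sq_sqrt h]
      · simp [Real.sqrt_eq_zero_of_nonpos h]

/-- The kinetic energy of `u`, weighted by `1 / l`, is at most the increment of `k` when the squared
increments of `u` are controlled by those of `k` and of the primitive of `l`. -/
theorem lintegral_metricDeriv_sq_le {u : ℝ → S} {k l : ℝ → ℝ} {s t : ℝ} (hst : s ≤ t)
    (hk : MonotoneOn k (Icc s t)) (hl : IntervalIntegrable l volume s t)
    (hlpos : ∀ r ∈ Ioo s t, 0 < l r)
    (hu : ∀ r ∈ Icc s t, ∀ r' ∈ Icc s t, r ≤ r' →
      dist (u r) (u r') ^ 2 ≤ 2 * (k r' - k r) * ∫ x in r..r', l x) :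
    (1 / 2) * ∫⁻ r in Ioo s t, ENNReal.ofReal (1 / l r) * metricDeriv u r ^ 2 ≤
      ENNReal.ofReal (k t - k s) := by
  rw [← lintegral_const_mul' _ _ (by simp)]
  refine lintegral_le_of_le_deriv_monotoneOn hst hk ?_
  filter_upwards [hl.ae_hasDerivAt_integral] with r hr hrm c hc
  have hrI := Ioo_subset_Icc_self hrm
  have hL := hr (by rwa [uIcc_of_le hst]) r (by rwa [uIcc_of_le hst])
  have hmd : metricDeriv u r ^ 2 ≤ ENNReal.ofReal (2 * c * l r) := by
    refine metricDeriv_sq_le hc hL ?_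
    filter_upwards [Icc_mem_nhds hrm.1 hrm.2] with x hx
    rw [intervalIntegral.integral_same, sub_zero]
    rcases le_total r x with h | h
    · exact hu r hrI x hx h
    · have := hu x hx r hrI h
      rw [intervalIntegral.integral_symm x r, dist_comm]
      linarith
  calc (1 / 2) * (ENNReal.ofReal (1 / l r) * metricDeriv u r ^ 2)
      ≤ (1 / 2) * (ENNReal.ofReal (1 / l r) * ENNReal.ofReal (2 * c * l r)) := by gcongr
    _ = ENNReal.ofReal (1 / 2) * (ENNReal.ofReal (1 / l r) * ENNReal.ofReal (2 * c * l r)) := by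
      rw [ENNReal.ofReal_div_of_pos two_pos]; simp
    _ = ENNReal.ofReal c := by
      have := hlpos r hrm
      rw [← ENNReal.ofReal_mul (by positivity), ← ENNReal.ofReal_mul (by positivity)]
      congr 1
      field_simp

end Curves

/-! ### Lower semicontinuity under weak convergence -/

/-- If `l n` converges to `l₀` weakly in `L¹` and the `H n` are arbitrary nonnegative measurable
functions, then `∫ l₀ liminf H n ≤ liminf ∫ l n H n`. -/
theorem lintegral_mul_liminf_le {α : Type*} [MeasurableSpace α] {μ : Measure α} {l : ℕ → α → ℝ}
    {l₀ : α → ℝ} (hl : ∀ n, Integrable (l n) μ) (hl₀ : Integrable l₀ μ)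
    (hpos : ∀ n, 0 ≤ᵐ[μ] l n) (hpos₀ : 0 ≤ᵐ[μ] l₀) {H : ℕ → α → ℝ≥0∞}
    (hH : ∀ n, Measurable (H n))
    (hweak : ∀ g : α → ℝ, Measurable g → (∃ C : ℝ, ∀ x, |g x| ≤ C) →
      Tendsto (fun n => ∫ x, g x * l n x ∂μ) atTop (𝓝 (∫ x, g x * l₀ x ∂μ))) :
    ∫⁻ x, ENNReal.ofReal (l₀ x) * liminf (fun n => H n x) atTop ∂μ ≤
      liminf (fun n => ∫⁻ x, ENNReal.ofReal (l n x) * H n x ∂μ) atTop := by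
  -- The truncated infima `min m (inf_{j ≥ m} H j)` are bounded and increase to the lower limit.
  set G : ℕ → α → ℝ≥0∞ := fun m x => min (m : ℝ≥0∞) (⨅ j ≥ m, H j x) with hG
  have hGm : ∀ m, Measurable (G m) := fun m =>
    measurable_const.min (Measurable.iInf fun j => Measurable.iInf fun _ => hH j)
  have hmono : ∀ x, Monotone fun m => ⨅ j ≥ m, H j x := fun x m m' h =>
    biInf_mono fun j hj => le_trans h hj
  have hGmono : ∀ x, Monotone fun m => G m x := fun x m m' h =>
    min_le_min (by exact_mod_cast h) (hmono x h)
  have hGsup : ∀ x, liminf (fun n => H n x) atTop = ⨆ m, G m x := by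
    intro x
    rw [liminf_eq_iSup_iInf_of_nat]
    refine tendsto_nhds_unique (tendsto_atTop_iSup (hmono x)) ?_
    have h1 := (ENNReal.tendsto_nat_nhds_top).min (tendsto_atTop_iSup (hmono x))
    rw [min_eq_right le_top] at h1
    have h2 := tendsto_atTop_iSup (hGmono x)
    rw [tendsto_nhds_unique h2 h1]
    exact tendsto_atTop_iSup (hmono x)
  have hGtop : ∀ m x, G m x ≠ ⊤ := fun m x =>
    ne_top_of_le_ne_top (ENNReal.natCast_ne_top m) (min_le_left _ _)
  have hGbd : ∀ m x, |(G m x).toReal| ≤ m := fun m x => by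
    rw [abs_of_nonneg ENNReal.toReal_nonneg]
    exact ENNReal.toReal_le_of_le_ofReal (by positivity) (by
      rw [ENNReal.ofReal_natCast]; exact min_le_left _ _)
  have hconv : ∀ m (f : α → ℝ), Integrable f μ → 0 ≤ᵐ[μ] f →
      ∫⁻ x, ENNReal.ofReal (f x) * G m x ∂μ = ENNReal.ofReal (∫ x, (G m x).toReal * f x ∂μ) := by
    intro m f hf hf0
    rw [ofReal_integral_eq_lintegral_ofReal]
    · refine lintegral_congr fun x => ?_
      rw [ENNReal.ofReal_mul ENNReal.toReal_nonneg, ENNReal.ofReal_toReal (hGtop m x), mul_comm]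
    · exact hf.bdd_mul (hGm m).ennreal_toReal.aestronglyMeasurable
        (Eventually.of_forall (hGbd m))
    · filter_upwards [hf0] with x hx using mul_nonneg ENNReal.toReal_nonneg hx
  simp_rw [hGsup, ENNReal.mul_iSup]
  rw [lintegral_iSup' (f := fun m x => ENNReal.ofReal (l₀ x) * G m x)
    (fun m => hl₀.aemeasurable.ennreal_ofReal.mul (hGm m).aemeasurable)
    (Eventually.of_forall fun x m m' h => by dsimp only; gcongr; exact hGmono x h)]
  refine iSup_le fun m => ?_
  rw [hconv m l₀ hl₀ hpos₀]
  have ht := ENNReal.tendsto_ofReal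
    (hweak (fun x => (G m x).toReal) (hGm m).ennreal_toReal ⟨m, hGbd m⟩)
  rw [← ht.liminf_eq]
  refine liminf_le_liminf ?_
  filter_upwards [eventually_ge_atTop m] with n hn
  rw [← hconv m _ (hl n) (hpos n)]
  refine lintegral_mono fun x => ?_
  gcongr
  exact (min_le_right _ _).trans (iInf₂_le n hn)

/-! ### De Giorgi's variational interpolation -/

section Interpolation

variable {S : Type*} [MetricSpace S]

/-- `z` minimizes `v ↦ φ(v) + c d²(v, x)`. -/
def IsProx (φ : S → EReal) (c : ℝ) (x z : S) : Prop :=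
  ∀ v, φ z + ((c * dist z x ^ 2 : ℝ) : EReal) ≤ φ v + ((c * dist v x ^ 2 : ℝ) : EReal)

namespace IsProx

variable {φ : S → EReal} {c c' : ℝ} {x z z' : S}

theorem ne_top (h : IsProx φ c x z) (hx : φ x ≠ ⊤) : φ z ≠ ⊤ := by
  intro hz
  have := h x
  rw [hz, EReal.top_add_coe, top_le_iff] at this
  exact EReal.add_ne_top hx (EReal.coe_ne_top _) this

theorem toReal_le (hbot : ∀ v, φ v ≠ ⊥) (h : IsProx φ c x z) (hx : φ x ≠ ⊤) {v : S}
    (hv : φ v ≠ ⊤) :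
    (φ z).toReal + c * dist z x ^ 2 ≤ (φ v).toReal + c * dist v x ^ 2 := by
  have := h v
  rw [← EReal.coe_toReal (h.ne_top hx) (hbot z), ← EReal.coe_toReal hv (hbot v)] at this
  exact_mod_cast this

/-- A larger penalization brings the minimizer closer to `x`. -/
theorem dist_le (hbot : ∀ v, φ v ≠ ⊥) (h : IsProx φ c x z) (h' : IsProx φ c' x z')
    (hx : φ x ≠ ⊤) (hc : c < c') : dist z' x ≤ dist z x := by
  have h1 := h.toReal_le hbot hx (h'.ne_top hx)
  have h2 := h'.toReal_le hbot hx (h.ne_top hx)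
  refine abs_le_of_sq_le_sq' ?_ dist_nonneg |>.2
  nlinarith

theorem value_le (hbot : ∀ v, φ v ≠ ⊥) (h : IsProx φ c x z) (h' : IsProx φ c' x z')
    (hx : φ x ≠ ⊤) (hc0 : 0 ≤ c) (hd : dist z' x ≤ dist z x) :
    (φ z).toReal ≤ (φ z').toReal := by
  have h1 := h.toReal_le hbot hx (h'.ne_top hx)
  have : c * dist z' x ^ 2 ≤ c * dist z x ^ 2 := by gcongr
  linarith

/-- Minimality bounds the difference quotients of `φ` at `z` by those of `c d²(·, x)`. -/
theorem localSlope_le (hbot : ∀ v, φ v ≠ ⊥) (h : IsProx φ c x z) (hx : φ x ≠ ⊤) (hc : 0 ≤ c) :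
    localSlope φ z ≤ ENNReal.ofReal (2 * c * dist z x) := by
  rw [localSlope, if_neg (h.ne_top hx)]
  have hle : ∀ v, v ≠ z → (φ z - φ v).toENNReal / edist z v ≤
      ENNReal.ofReal (c * (2 * dist z x + dist v z)) := by
    intro v hv
    by_cases hvt : φ v = ⊤
    · simp [hvt]
    have hpos : 0 < dist z v := dist_pos.2 (Ne.symm hv)
    rw [← EReal.coe_toReal (h.ne_top hx) (hbot z), ← EReal.coe_toReal hvt (hbot v),
      ← EReal.coe_sub, EReal.toENNReal_of_ne_top (EReal.coe_ne_top _), EReal.toReal_coe,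
      edist_dist, ← ENNReal.ofReal_div_of_pos hpos]
    refine ENNReal.ofReal_le_ofReal ((div_le_iff₀ hpos).2 ?_)
    have h1 := h.toReal_le hbot hx hvt
    have h2 : dist v x ≤ dist z v + dist z x := by
      rw [dist_comm z v]; exact dist_triangle _ _ _
    have h3 : dist v x ^ 2 ≤ (dist z v + dist z x) ^ 2 := by gcongr
    rw [dist_comm v z]
    nlinarith
  have hlim : Tendsto (fun v => ENNReal.ofReal (c * (2 * dist z x + dist v z))) (𝓝[≠] z)
      (𝓝 (ENNReal.ofReal (2 * c * dist z x))) := by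
    refine Tendsto.mono_left ?_ nhdsWithin_le_nhds
    have : Continuous fun v => ENNReal.ofReal (c * (2 * dist z x + dist v z)) :=
      ENNReal.continuous_ofReal.comp (by fun_prop)
    have := this.tendsto z
    rw [dist_self, add_zero] at this
    convert this using 3
    ring
  rcases (𝓝[≠] z).eq_or_neBot with hbt | hne
  · simp [hbt]
  · rw [← hlim.limsup_eq]
    refine limsup_le_limsup ?_
    filter_upwards [self_mem_nhdsWithin] with v hv using hle v hv

end IsProx

/-- De Giorgi's variational interpolant between `x` and `y`: for `θ ∈ (0, τ]` the point `z θ`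
minimizes `v ↦ φ(v) + a d²(v, x) / (2 θ)`, with `z τ = y`. It is extended by constants, so that
`θ ↦ d(z θ, x)` is monotone on the whole line. -/
structure IsVariationalInterpolant (φ : S → EReal) (a τ : ℝ) (x y : S) (z : ℝ → S) : Prop where
  left : ∀ θ ≤ 0, z θ = x
  right : ∀ θ, τ ≤ θ → z θ = y
  prox : ∀ θ ∈ Ioc 0 τ, IsProx φ (a / (2 * θ)) x (z θ)

namespace IsVariationalInterpolant

variable {φ : S → EReal} {a τ : ℝ} {x y : S} {z : ℝ → S}

theorem monotone_dist (hbot : ∀ v, φ v ≠ ⊥) (ha : 0 < a)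
    (h : IsVariationalInterpolant φ a τ x y z) (hx : φ x ≠ ⊤) :
    Monotone fun θ => dist (z θ) x := by
  have key : ∀ θ θ', 0 < θ → θ < θ' → θ' ≤ τ → dist (z θ) x ≤ dist (z θ') x := by
    intro θ θ' h0 h1 h2
    refine (h.prox θ' ⟨h0.trans h1, h2⟩).dist_le hbot (h.prox θ ⟨h0, h1.le.trans h2⟩) hx ?_
    gcongr
  intro θ θ' hθ
  dsimp only
  rcases hθ.eq_or_lt with rfl | hlt
  · exact le_rfl
  rcases le_or_gt θ 0 with h0 | h0
  · rw [h.left θ h0, dist_self]; exact dist_nonneg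
  rcases le_or_gt θ' τ with h1 | h1
  · exact key θ θ' h0 hlt h1
  rw [h.right θ' h1.le]
  rcases lt_or_ge θ τ with h2 | h2
  · have := key θ τ h0 h2 le_rfl
    rwa [h.right τ le_rfl] at this
  · rw [h.right θ h2]

theorem dist_le (hbot : ∀ v, φ v ≠ ⊥) (ha : 0 < a)
    (h : IsVariationalInterpolant φ a τ x y z) (hx : φ x ≠ ⊤) (θ : ℝ) :
    dist (z θ) x ≤ dist y x := by
  rw [← h.right (max θ τ) (le_max_right _ _)]
  exact h.monotone_dist hbot ha hx (le_max_left _ _)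

theorem value_mem (hbot : ∀ v, φ v ≠ ⊥) (ha : 0 < a)
    (h : IsVariationalInterpolant φ a τ x y z) (hx : φ x ≠ ⊤) {θ : ℝ} (hθ : θ ∈ Ioc 0 τ) :
    (φ y).toReal ≤ (φ (z θ)).toReal ∧ (φ (z θ)).toReal ≤ (φ x).toReal := by
  have hτ : 0 < τ := hθ.1.trans_le hθ.2
  have hθ0 := hθ.1
  constructor
  · have hy := h.prox τ ⟨hτ, le_rfl⟩
    rw [h.right τ le_rfl] at hy
    exact hy.value_le hbot (h.prox θ hθ) hx (by positivity) (h.dist_le hbot ha hx θ)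
  · have := (h.prox θ hθ).toReal_le hbot hx hx
    rw [dist_self] at this
    have h2 : 0 ≤ a / (2 * θ) * dist (z θ) x ^ 2 := by positivity
    linarith

/-- The energy inequality for one step: the dissipation of the step is at least its kinetic energy
plus the integral of the squared slope bound along the variational interpolant. -/
theorem lintegral_slope_le (hbot : ∀ v, φ v ≠ ⊥) (ha : 0 < a) (hτ : 0 < τ)
    (h : IsVariationalInterpolant φ a τ x y z) (hx : φ x ≠ ⊤) :
    ∫⁻ θ in Ioo 0 τ, ENNReal.ofReal (1 / 2 * (1 / a * (a * dist (z θ) x / θ) ^ 2)) ≤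
      ENNReal.ofReal ((φ x).toReal - (φ y).toReal - a / (2 * τ) * dist y x ^ 2) := by
  -- `-k` is the Moreau-Yosida regularization of `φ` at `x`, as a function of the step.
  set k : ℝ → ℝ := fun θ =>
    -(if θ ≤ 0 then (φ x).toReal else (φ (z θ)).toReal + a / (2 * θ) * dist (z θ) x ^ 2) with hk
  have hk0 : k 0 = -(φ x).toReal := by simp [hk]
  have hkpos : ∀ θ, 0 < θ → k θ = -((φ (z θ)).toReal + a / (2 * θ) * dist (z θ) x ^ 2) :=
    fun θ hθ => by simp [hk, not_le.2 hθ]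
  have hkey : ∀ θ θ', 0 < θ → θ ≤ θ' → θ' ≤ τ →
      k θ + a * dist (z θ) x ^ 2 / 2 * (1 / θ) ≤ k θ' + a * dist (z θ) x ^ 2 / 2 * (1 / θ') := by
    intro θ θ' h0 h1 h2
    have := (h.prox θ' ⟨h0.trans_le h1, h2⟩).toReal_le hbot hx
      ((h.prox θ ⟨h0, h1.trans h2⟩).ne_top hx)
    rw [hkpos θ h0, hkpos θ' (h0.trans_le h1)]
    have e1 : a / (2 * θ) * dist (z θ) x ^ 2 = a * dist (z θ) x ^ 2 / 2 * (1 / θ) := by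
      field_simp
    have e2 : a / (2 * θ') * dist (z θ) x ^ 2 = a * dist (z θ) x ^ 2 / 2 * (1 / θ') := by
      field_simp
    linarith
  have hmono : MonotoneOn k (Icc 0 τ) := by
    intro θ hθ θ' hθ' hle
    rcases hθ.1.eq_or_lt with rfl | h0
    · rcases hθ'.1.eq_or_lt with rfl | h0'
      · exact le_rfl
      rw [hk0, hkpos θ' h0']
      have := (h.prox θ' ⟨h0', hθ'.2⟩).toReal_le hbot hx hx
      rw [dist_self] at this
      linarith
    · have h1 := hkey θ θ' h0 hle hθ'.2
      have h2 : a * dist (z θ) x ^ 2 / 2 * (1 / θ') ≤ a * dist (z θ) x ^ 2 / 2 * (1 / θ) := by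
        gcongr
      linarith
  have hkτ : k τ - k 0 = (φ x).toReal - (φ y).toReal - a / (2 * τ) * dist y x ^ 2 := by
    rw [hk0, hkpos τ hτ, h.right τ le_rfl]; ring
  rw [← hkτ]
  refine lintegral_le_of_le_deriv_monotoneOn hτ.le hmono
    (Eventually.of_forall fun r hr c hc => ENNReal.ofReal_le_ofReal ?_)
  -- `k + a d²(z r, x) / (2 ·)` lies above its value at `r` on the right of `r`.
  have hd : HasDerivAt (fun θ => k θ + a * dist (z r) x ^ 2 / 2 * (1 / θ))
      (c + a * dist (z r) x ^ 2 / 2 * (-(r ^ 2)⁻¹)) r := by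
    simp_rw [one_div]
    exact hc.add ((hasDerivAt_inv hr.1.ne').const_mul _)
  have hnn : 0 ≤ c + a * dist (z r) x ^ 2 / 2 * (-(r ^ 2)⁻¹) := by
    refine ge_of_tendsto ((hasDerivAt_iff_tendsto_slope.1 hd).mono_left
      (nhdsWithin_mono r (show Ioi r ⊆ {r}ᶜ from fun y hy => ne_of_gt hy))) ?_
    filter_upwards [Ioo_mem_nhdsGT hr.2] with θ hθ
    rw [slope_def_field]
    exact div_nonneg (sub_nonneg.2 (hkey r θ hr.1 hθ.1.le hθ.2.le)) (sub_nonneg.2 hθ.1.le)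
  have e : 1 / 2 * (1 / a * (a * dist (z r) x / r) ^ 2) =
      a * dist (z r) x ^ 2 / 2 * (r ^ 2)⁻¹ := by
    have := hr.1.ne'
    field_simp
  rw [e]
  linarith

end IsVariationalInterpolant

/-- A variational interpolant exists as soon as the minimum problems are solvable. -/
theorem exists_isVariationalInterpolant {φ : S → EReal} {a τ : ℝ} {x y : S} (hτ : 0 < τ)
    (hy : IsProx φ (a / (2 * τ)) x y)
    (hex : ∀ θ ∈ Ioo 0 τ, ∃ z, IsProx φ (a / (2 * θ)) x z) :
    ∃ z, IsVariationalInterpolant φ a τ x y z := by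
  classical
  have : ∀ θ : ℝ, ∃ z, (θ ≤ 0 → z = x) ∧ (τ ≤ θ → z = y) ∧
      (θ ∈ Ioc 0 τ → IsProx φ (a / (2 * θ)) x z) := by
    intro θ
    rcases le_or_gt θ 0 with h0 | h0
    · exact ⟨x, fun _ => rfl, fun h => by linarith, fun h => absurd h.1 (not_lt.2 h0)⟩
    rcases lt_or_ge θ τ with h1 | h1
    · obtain ⟨z, hz⟩ := hex θ ⟨h0, h1⟩
      exact ⟨z, fun h => by linarith, fun h => by linarith, fun _ => hz⟩
    · refine ⟨y, fun h => by linarith, fun _ => rfl, fun h => ?_⟩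
      rwa [le_antisymm h.2 h1]
  choose z h1 h2 h3 using this
  exact ⟨z, h1, h2, h3⟩

end Interpolation

/-- The sum of two lower semicontinuous functions attains its minimum when a sublevel set
is contained in a compact set. -/
theorem exists_forall_add_le {X : Type*} [TopologicalSpace X] {f : X → EReal} {g : X → ℝ}
    (hf : LowerSemicontinuous f) (hg : LowerSemicontinuous g) {K : Set X} (hK : IsCompact K)
    (x : X) (hxK : ∀ v, f v + (g v : EReal) ≤ f x + (g x : EReal) → v ∈ K) :
    ∃ z, ∀ v, f z + (g z : EReal) ≤ f v + (g v : EReal) := by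
  have hg' : LowerSemicontinuous fun v => (g v : EReal) :=
    continuous_coe_real_ereal.comp_lowerSemicontinuous hg EReal.coe_strictMono.monotone
  have hsum : LowerSemicontinuous fun v => f v + (g v : EReal) := by
    refine hf.add' hg' fun v => ?_
    exact EReal.continuousAt_add (.inr (EReal.coe_ne_bot _)) (.inr (EReal.coe_ne_top _))
  obtain ⟨z, hz, hmin⟩ := (hsum.lowerSemicontinuousOn K).exists_isMinOn ⟨x, hxK x le_rfl⟩ hK
  refine ⟨z, fun v => ?_⟩
  by_cases hv : v ∈ K
  · exact hmin hv
  · exact (hmin (hxK x le_rfl)).trans (le_of_lt (not_le.1 fun h => hv (hxK v h)))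

/-! ### Energy estimates for a single discrete solution -/

theorem ceil_div_eq {τ t : ℝ} (hτ : 0 < τ) {n : ℕ} (ht : t ∈ Ioc (n * τ) ((n + 1) * τ)) :
    ⌈t / τ⌉₊ = n + 1 := by
  rw [Nat.ceil_eq_iff (Nat.succ_ne_zero n)]
  constructor
  · rw [lt_div_iff₀ hτ]; simpa using ht.1
  · rw [div_le_iff₀ hτ]; push_cast; exact ht.2

theorem mem_Ioc_of_ceil_div_eq {τ t : ℝ} (hτ : 0 < τ) {n : ℕ} (ht : ⌈t / τ⌉₊ = n + 1) :
    t ∈ Ioc (n * τ) ((n + 1) * τ) := by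
  rw [Nat.ceil_eq_iff (Nat.succ_ne_zero n), lt_div_iff₀ hτ, div_le_iff₀ hτ] at ht
  simpa using ht

/-- The integral of the piecewise constant interpolation over whole steps. -/
theorem integral_interp {a : ℕ → ℝ} {τ : ℝ} (hτ : 0 < τ) {m N : ℕ} (hmN : m ≤ N) :
    ∫ r in (m * τ)..(N * τ), 1 / a ⌈r / τ⌉₊ = ∑ i ∈ Finset.Ico m N, τ / a (i + 1) := by
  have hae : ∀ i : ℕ, ∀ r ∈ uIoc (i * τ) ((i + 1 : ℕ) * τ),
      1 / a ⌈r / τ⌉₊ = 1 / a (i + 1) := by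
    intro i r hr
    rw [uIoc_of_le (by gcongr; simp)] at hr
    rw [ceil_div_eq hτ (by simpa using hr)]
  have hint : ∀ i : ℕ, IntervalIntegrable (fun r => 1 / a ⌈r / τ⌉₊) volume (i * τ)
      ((i + 1 : ℕ) * τ) := by
    intro i
    refine (intervalIntegrable_congr fun r hr => ?_).2
      (intervalIntegrable_const (c := 1 / a (i + 1)))
    exact hae i r hr
  rw [← intervalIntegral.sum_integral_adjacent_intervals_Ico (a := fun i : ℕ => (i : ℝ) * τ) hmN
    fun i _ => hint i]
  refine Finset.sum_congr rfl fun i _ => ?_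
  rw [intervalIntegral.integral_congr_ae (Eventually.of_forall (hae i)),
    intervalIntegral.integral_const]
  push_cast
  rw [smul_eq_mul]
  ring

section Discrete

variable {S : Type*} [MetricSpace S] {φ : S → EReal} {τ : ℝ} {a : ℕ → ℝ} {x₀ : S} {w : ℕ → S}

namespace IsDiscreteSolution

theorem isProx (h : IsDiscreteSolution φ τ a x₀ w) (n : ℕ) :
    IsProx φ (a (n + 1) / (2 * τ)) (w n) (w (n + 1)) := by
  intro v
  have := h.step n v
  convert this using 3 <;> ring

theorem ne_top (h : IsDiscreteSolution φ τ a x₀ w) (n : ℕ) : φ (w n) ≠ ⊤ := by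
  induction n with
  | zero => exact h.init_dom
  | succ n ih => exact (h.isProx n).ne_top ih

theorem step_le (hbot : ∀ v, φ v ≠ ⊥) (h : IsDiscreteSolution φ τ a x₀ w) (n : ℕ) :
    a (n + 1) / τ * dist (w n) (w (n + 1)) ^ 2 ≤
      2 * ((φ (w n)).toReal - (φ (w (n + 1))).toReal) := by
  have := (h.isProx n).toReal_le hbot (h.ne_top n) (h.ne_top n)
  rw [dist_self, dist_comm] at this
  have e : a (n + 1) / (2 * τ) * dist (w n) (w (n + 1)) ^ 2 =
    (a (n + 1) / τ * dist (w n) (w (n + 1)) ^ 2) / 2 := by ring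
  rw [e] at this
  linarith

theorem sum_le (hbot : ∀ v, φ v ≠ ⊥) (h : IsDiscreteSolution φ τ a x₀ w) {m N : ℕ}
    (hmN : m ≤ N) :
    ∑ i ∈ Finset.Ico m N, a (i + 1) / τ * dist (w i) (w (i + 1)) ^ 2 ≤
      2 * ((φ (w m)).toReal - (φ (w N)).toReal) := by
  calc _ ≤ ∑ i ∈ Finset.Ico m N, 2 * ((φ (w i)).toReal - (φ (w (i + 1))).toReal) :=
        Finset.sum_le_sum fun i _ => h.step_le hbot i
    _ = _ := by
      rw [← Finset.mul_sum]
      congr 1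
      have := Finset.sum_Ico_sub (fun i => (φ (w i)).toReal) hmN
      rw [← neg_sub, ← this, ← Finset.sum_neg_distrib]
      exact Finset.sum_congr rfl fun i _ => by ring

theorem antitone (hbot : ∀ v, φ v ≠ ⊥) (hτ : 0 < τ) (ha : ∀ n, 1 ≤ n → 0 < a n)
    (h : IsDiscreteSolution φ τ a x₀ w) : Antitone fun n => (φ (w n)).toReal := by
  refine antitone_nat_of_succ_le fun n => ?_
  have h1 := h.step_le hbot n
  have := ha (n + 1) (by simp)
  have : 0 ≤ a (n + 1) / τ * dist (w n) (w (n + 1)) ^ 2 := by positivity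
  linarith

/-- The Cauchy-Schwarz inequality for the length of a discrete solution. -/
theorem dist_sq_le (hτ : 0 < τ) (ha : ∀ n, 1 ≤ n → 0 < a n) {m N : ℕ} (hmN : m ≤ N) :
    dist (w m) (w N) ^ 2 ≤
      (∑ i ∈ Finset.Ico m N, a (i + 1) / τ * dist (w i) (w (i + 1)) ^ 2) *
        ∫ r in (m * τ)..(N * τ), 1 / a ⌈r / τ⌉₊ := by
  rw [integral_interp hτ hmN]
  calc dist (w m) (w N) ^ 2 ≤ (∑ i ∈ Finset.Ico m N, dist (w i) (w (i + 1))) ^ 2 := by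
        gcongr; exact dist_le_Ico_sum_dist w hmN
    _ ≤ _ := by
      refine Finset.sum_sq_le_sum_mul_sum_of_sq_le_mul _ (fun i _ => ?_) (fun i _ => ?_)
        (fun i _ => ?_)
      · have := ha (i + 1) (by simp); positivity
      · have := ha (i + 1) (by simp); positivity
      · have := ha (i + 1) (by simp); refine le_of_eq ?_; field_simp

end IsDiscreteSolution

/-- `Z` is the variational interpolation of the whole discrete solution `w`, and `H` the measurable
upper bound `a d(Z, w n) / θ` for the slope along it, `θ` being the time elapsed since the last
step. -/
structure IsInterpolation (φ : S → EReal) (τ : ℝ) (a : ℕ → ℝ) (w : ℕ → S) (Z : ℝ → S)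
    (H : ℝ → ℝ) : Prop where
  measurable : Measurable H
  ne_top : ∀ t, φ (Z t) ≠ ⊤
  value_mem : ∀ t n, ⌈t / τ⌉₊ = n + 1 →
    (φ (w (n + 1))).toReal ≤ (φ (Z t)).toReal ∧ (φ (Z t)).toReal ≤ (φ (w n)).toReal
  dist_le : ∀ t n, ⌈t / τ⌉₊ = n + 1 → dist (Z t) (w n) ≤ dist (w (n + 1)) (w n)
  slope_le : ∀ t, 0 < t → localSlope φ (Z t) ≤ ENNReal.ofReal (H t)
  energy : ∀ n : ℕ, ∫⁻ t in Ioc (n * τ) ((n + 1 : ℕ) * τ),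
      ENNReal.ofReal (1 / a ⌈t / τ⌉₊) * ENNReal.ofReal (H t) ^ 2 ≤
    ENNReal.ofReal (2 * ((φ (w n)).toReal - (φ (w (n + 1))).toReal) -
      a (n + 1) / τ * dist (w n) (w (n + 1)) ^ 2)

theorem IsDiscreteSolution.exists_isInterpolation (hbot : ∀ v, φ v ≠ ⊥) (hτ : 0 < τ)
    (ha : ∀ n, 1 ≤ n → 0 < a n) (h : IsDiscreteSolution φ τ a x₀ w)
    (hex : ∀ n, ∀ c > 0, ∃ z, IsProx φ c (w n) z) :
    ∃ Z H, IsInterpolation φ τ a w Z H := by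
  have ha' : ∀ n, 0 < a (n + 1) := fun n => ha _ (by simp)
  have : ∀ n, ∃ z, IsVariationalInterpolant φ (a (n + 1)) τ (w n) (w (n + 1)) z := fun n =>
    exists_isVariationalInterpolant hτ (h.isProx n) fun θ hθ => hex n _ (by
      have := ha' n; have := hθ.1; positivity)
  choose z hz using this
  set I : ℝ → ℕ := fun t => ⌈t / τ⌉₊ - 1 with hI
  have hIn : ∀ t n, ⌈t / τ⌉₊ = n + 1 → I t = n := fun t n hn => by simp [hI, hn]
  have hθ : ∀ t n, ⌈t / τ⌉₊ = n + 1 → t - n * τ ∈ Ioc 0 τ := fun t n hn => by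
    have := mem_Ioc_of_ceil_div_eq hτ hn
    constructor <;> linarith [this.1, this.2]
  have hpos : ∀ t, 0 < t → ∃ n, ⌈t / τ⌉₊ = n + 1 := fun t ht =>
    Nat.exists_eq_succ_of_ne_zero (Nat.ceil_pos.2 (div_pos ht hτ)).ne'
  refine ⟨fun t => z (I t) (t - I t * τ), fun t =>
    a (I t + 1) * dist (z (I t) (t - I t * τ)) (w (I t)) / (t - I t * τ), ?_, ?_, ?_, ?_, ?_, ?_⟩
  · have hIm : Measurable I :=
      (Measurable.of_discrete (f := fun n : ℕ => n - 1)).comp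
        (Nat.measurable_ceil.comp (measurable_id.div_const τ))
    have : Measurable fun p : ℕ × ℝ =>
        a (p.1 + 1) * dist (z p.1 (p.2 - p.1 * τ)) (w p.1) / (p.2 - p.1 * τ) := by
      refine measurable_from_prod_countable_right fun n => ?_
      have h1 : Measurable fun θ => dist (z n θ) (w n) :=
        ((hz n).monotone_dist hbot (ha' n) (h.ne_top n)).measurable
      have h2 : Measurable fun t : ℝ => t - n * τ := measurable_id.sub_const _
      exact Measurable.div (f := fun t : ℝ => a (n + 1) * dist (z n (t - n * τ)) (w n))
        ((h1.comp h2).const_mul (a (n + 1))) h2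
    exact this.comp (hIm.prodMk measurable_id)
  · intro t
    rcases le_or_gt (t - I t * τ) 0 with h0 | h0
    · rw [(hz _).left _ h0]; exact h.ne_top _
    rcases le_or_gt (t - I t * τ) τ with h1 | h1
    · exact ((hz _).prox _ ⟨h0, h1⟩).ne_top (h.ne_top _)
    · rw [(hz _).right _ h1.le]; exact h.ne_top _
  · intro t n hn
    rw [hIn t n hn]
    exact (hz n).value_mem hbot (ha' n) (h.ne_top n) (hθ t n hn)
  · intro t n hn
    rw [hIn t n hn]
    exact (hz n).dist_le hbot (ha' n) (h.ne_top n) _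
  · intro t ht
    obtain ⟨n, hn⟩ := hpos t ht
    rw [hIn t n hn]
    have hm := hθ t n hn
    have hm0 := hm.1
    have := ha' n
    refine (((hz n).prox _ hm).localSlope_le hbot (h.ne_top n) (by positivity)).trans_eq ?_
    congr 1
    field_simp
  · intro n
    have hle := (hz n).lintegral_slope_le hbot (ha' n) hτ (h.ne_top n)
    have hmp := (measurePreserving_sub_right volume (n * τ)).setLIntegral_comp_preimage_emb
      (MeasurableEquiv.subRight (n * τ)).measurableEmbedding
      (fun θ => ENNReal.ofReal
        (1 / 2 * (1 / a (n + 1) * (a (n + 1) * dist (z n θ) (w n) / θ) ^ 2))) (Ioo 0 τ)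
    rw [← hmp, preimage_sub_const_Ioo, zero_add] at hle
    have e : τ + n * τ = (n + 1 : ℕ) * τ := by push_cast; ring
    rw [e] at hle
    rw [← restrict_Ioo_eq_restrict_Ioc]
    have hcongr : ∫⁻ t in Ioo (n * τ) ((n + 1 : ℕ) * τ), ENNReal.ofReal (1 / a ⌈t / τ⌉₊) *
        ENNReal.ofReal (a (I t + 1) * dist (z (I t) (t - I t * τ)) (w (I t)) / (t - I t * τ)) ^ 2 =
        2 * ∫⁻ t in Ioo (n * τ) ((n + 1 : ℕ) * τ), ENNReal.ofReal (1 / 2 * (1 / a (n + 1) *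
          (a (n + 1) * dist (z n (t - n * τ)) (w n) / (t - n * τ)) ^ 2)) := by
      rw [← lintegral_const_mul' _ _ (by simp)]
      refine setLIntegral_congr_fun measurableSet_Ioo fun t ht => ?_
      have hn : ⌈t / τ⌉₊ = n + 1 :=
        ceil_div_eq hτ ⟨ht.1, by have := ht.2; push_cast at this; exact this.le⟩
      have := ha' n
      have := (hθ t n hn).1
      rw [hIn t n hn, hn, ← ENNReal.ofReal_pow (by positivity),
        ← ENNReal.ofReal_mul (by positivity), ← ENNReal.ofReal_ofNat 2,
        ← ENNReal.ofReal_mul (by positivity)]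
      congr 1
      ring
    rw [hcongr]
    calc _ ≤ 2 * ENNReal.ofReal ((φ (w n)).toReal - (φ (w (n + 1))).toReal -
          a (n + 1) / (2 * τ) * dist (w (n + 1)) (w n) ^ 2) := by gcongr
      _ = _ := by
        rw [← ENNReal.ofReal_ofNat 2, ← ENNReal.ofReal_mul (by positivity), dist_comm]
        congr 1
        ring

theorem IsInterpolation.lintegral_le (hbot : ∀ v, φ v ≠ ⊥) {Z : ℝ → S} {H : ℝ → ℝ}
    (hZ : IsInterpolation φ τ a w Z H) (hτ : 0 < τ) (h : IsDiscreteSolution φ τ a x₀ w)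
    {m N : ℕ} (hmN : m ≤ N) :
    ∫⁻ t in Ioc (m * τ) (N * τ), ENNReal.ofReal (1 / a ⌈t / τ⌉₊) * ENNReal.ofReal (H t) ^ 2 ≤
      ENNReal.ofReal (2 * ((φ (w m)).toReal - (φ (w N)).toReal) -
        ∑ i ∈ Finset.Ico m N, a (i + 1) / τ * dist (w i) (w (i + 1)) ^ 2) := by
  induction N, hmN using Nat.le_induction with
  | base => simp
  | succ N hmN ih =>
    have hu : Ioc (m * τ) ((N + 1 : ℕ) * τ) =
        Ioc (m * τ) (N * τ) ∪ Ioc (N * τ) ((N + 1 : ℕ) * τ) := by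
      rw [Ioc_union_Ioc_eq_Ioc] <;> gcongr
      simp
    have htel := h.sum_le hbot hmN
    have hstep := h.step_le hbot N
    rw [hu, Finset.sum_Ico_succ_top hmN]
    refine (lintegral_union_le _ _ _).trans ((add_le_add ih (hZ.energy N)).trans_eq ?_)
    rw [← ENNReal.ofReal_add (by linarith) (by linarith)]
    congr 1
    ring

/-- The discrete energy inequality. Its kinetic term is bounded below, through the Cauchy-Schwarz
inequality, by the squared displacement over the integral of `1 / a`. -/
theorem IsInterpolation.energy_inequality (hbot : ∀ v, φ v ≠ ⊥) {Z : ℝ → S} {H : ℝ → ℝ}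
    (hZ : IsInterpolation φ τ a w Z H) (hτ : 0 < τ) (ha : ∀ n, 1 ≤ n → 0 < a n)
    (h : IsDiscreteSolution φ τ a x₀ w) {m N : ℕ} (hmN : m ≤ N) {e : ℝ}
    (heI : ENNReal.ofReal e ≤ ∫⁻ t in Ioc (m * τ) (N * τ),
      ENNReal.ofReal (1 / a ⌈t / τ⌉₊) * ENNReal.ofReal (H t) ^ 2) :
    e ≤ 2 * ((φ (w m)).toReal - (φ (w N)).toReal) ∧
    dist (w m) (w N) ^ 2 ≤ (2 * ((φ (w m)).toReal - (φ (w N)).toReal) - e) *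
        ∫ r in (m * τ)..(N * τ), 1 / a ⌈r / τ⌉₊ := by
  have hsum := h.sum_le hbot hmN
  have h1 := heI.trans (hZ.lintegral_le hbot hτ h hmN)
  rw [ENNReal.ofReal_le_ofReal_iff (by linarith)] at h1
  have hnn : 0 ≤ ∑ i ∈ Finset.Ico m N, a (i + 1) / τ * dist (w i) (w (i + 1)) ^ 2 :=
    Finset.sum_nonneg fun i _ => by have := ha (i + 1) (by simp); positivity
  refine ⟨by linarith, (IsDiscreteSolution.dist_sq_le hτ ha hmN).trans ?_⟩
  have hL : 0 ≤ ∫ r in (m * τ)..(N * τ), 1 / a ⌈r / τ⌉₊ := by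
    rw [integral_interp hτ hmN]
    exact Finset.sum_nonneg fun i _ => by have := ha (i + 1) (by simp); positivity
  gcongr
  linarith

/-- A priori bounds. The displacement is at most `2 M` times the energy drop, and coercivity with
constant `1 / (8 M)` allows the resulting quadratic term to be absorbed. -/
theorem IsDiscreteSolution.bounds (hbot : ∀ v, φ v ≠ ⊥) (hτ : 0 < τ)
    (ha : ∀ n, 1 ≤ n → 0 < a n) (h : IsDiscreteSolution φ τ a x₀ w) {p : S} {C₀ M B : ℝ}
    (hM : 0 < M) (hd : dist (w 0) p ≤ C₀) (hF : (φ (w 0)).toReal ≤ C₀)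
    (hB : ∀ v, φ v ≠ ⊤ → B ≤ (φ v).toReal + 1 / (8 * M) * dist v p ^ 2) {N : ℕ}
    (hL : ∫ r in (0 : ℝ)..(N * τ), 1 / a ⌈r / τ⌉₊ ≤ M) :
    dist (w N) p ^ 2 ≤ 4 * C₀ ^ 2 + 8 * M * (C₀ - B) ∧
      B - 1 / (8 * M) * (4 * C₀ ^ 2 + 8 * M * (C₀ - B)) ≤ (φ (w N)).toReal := by
  have h1 := IsDiscreteSolution.dist_sq_le (w := w) hτ ha (Nat.zero_le N)
  rw [Nat.cast_zero, zero_mul] at h1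
  have h2 := h.sum_le hbot (Nat.zero_le N)
  have h3 : 0 ≤ ∑ i ∈ Finset.Ico 0 N, a (i + 1) / τ * dist (w i) (w (i + 1)) ^ 2 :=
    Finset.sum_nonneg fun i _ => by have := ha (i + 1) (by simp); positivity
  have h4 : dist (w 0) (w N) ^ 2 ≤ 2 * ((φ (w 0)).toReal - (φ (w N)).toReal) * M :=
    h1.trans (mul_le_mul h2 hL (by
      have := integral_interp (a := a) hτ (Nat.zero_le N)
      rw [Nat.cast_zero, zero_mul] at this
      rw [this]
      exact Finset.sum_nonneg fun i _ => by have := ha (i + 1) (by simp); positivity)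
      (h3.trans h2))
  have h5 := hB (w N) (h.ne_top N)
  have h6 : dist (w N) p ≤ dist (w 0) (w N) + C₀ := by
    rw [dist_comm (w 0)]
    exact (dist_triangle _ (w 0) _).trans (by linarith)
  have h7 : dist (w N) p ^ 2 ≤ (dist (w 0) (w N) + C₀) ^ 2 := by gcongr
  have h8 : dist (w N) p ^ 2 ≤ 2 * dist (w 0) (w N) ^ 2 + 2 * C₀ ^ 2 := by
    nlinarith [sq_nonneg (dist (w 0) (w N) - C₀)]
  have h9 : ((φ (w 0)).toReal - (φ (w N)).toReal) * M ≤
      (C₀ - B + 1 / (8 * M) * dist (w N) p ^ 2) * M := by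
    gcongr
    linarith
  have h10 : (C₀ - B + 1 / (8 * M) * dist (w N) p ^ 2) * M =
      (C₀ - B) * M + dist (w N) p ^ 2 / 8 := by
    field_simp
  have h11 : dist (w N) p ^ 2 ≤ 4 * C₀ ^ 2 + 8 * M * (C₀ - B) := by linarith
  refine ⟨h11, ?_⟩
  have : 1 / (8 * M) * dist (w N) p ^ 2 ≤ 1 / (8 * M) * (4 * C₀ ^ 2 + 8 * M * (C₀ - B)) := by
    gcongr
  linarith

end Discrete

/-! ### Weak topologies with a lower semicontinuous distance -/

section LscDistance

variable {X : Type*} [TopologicalSpace X] {d : X × X → ℝ}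

theorem lowerSemicontinuous_mul_sq (hd : LowerSemicontinuous d) (hd0 : ∀ p, 0 ≤ d p) {c : ℝ}
    (hc : 0 ≤ c) (x : X) : LowerSemicontinuous fun v => c * d (v, x) ^ 2 := by
  have h1 : LowerSemicontinuous fun v => d (v, x) :=
    hd.comp (g := fun v => (v, x)) (by fun_prop)
  have h2 : Continuous fun r : ℝ => c * max r 0 ^ 2 := by fun_prop
  have h3 : Monotone fun r : ℝ => c * max r 0 ^ 2 := fun r r' h => by
    dsimp only
    gcongr
  simpa [Function.comp_def, max_eq_left (hd0 _)] using h2.comp_lowerSemicontinuous h1 h3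

theorem eventually_sub_lt_of_tendsto {ι : Type*} {F : Filter ι} (hd : LowerSemicontinuous d)
    {v v' : ι → X} {x x' : X} (hv : Tendsto v F (𝓝 x)) (hv' : Tendsto v' F (𝓝 x')) {δ : ℝ}
    (hδ : 0 < δ) : ∀ᶠ k in F, d (x, x') - δ < d (v k, v' k) :=
  (hv.prodMk_nhds hv').eventually (hd (x, x') _ (sub_lt_self _ hδ))

/-- In a compact set, a sequence at vanishing distance from a convergent one has the same limit. -/
theorem tendsto_of_dist_tendsto_zero (hd : LowerSemicontinuous d)
    (hsep : ∀ x y, d (x, y) ≤ 0 → x = y) {K : Set X} (hK : IsCompact K) {v w : ℕ → X} {x : X}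
    (hvK : ∀ᶠ k in atTop, v k ∈ K) (hw : Tendsto w atTop (𝓝 x))
    (hvw : Tendsto (fun k => d (v k, w k)) atTop (𝓝 0)) : Tendsto v atTop (𝓝 x) := by
  refine hK.tendsto_nhds_of_unique_mapClusterPt hvK fun y _ hy => hsep y x ?_
  obtain ⟨U, hU, hUy⟩ := mapClusterPt_iff_ultrafilter.1 hy
  refine le_of_forall_pos_le_add fun δ hδ => ?_
  have h1 := eventually_sub_lt_of_tendsto hd hUy (hw.mono_left hU) hδ
  have h2 := ge_of_tendsto (hvw.mono_left hU) (h1.mono fun _ h => h.le)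
  linarith

end LscDistance

section Apriori

variable {S : Type*} [MetricSpace S]

theorem ExistenceAssumptions.exists_isProx {σ : TopologicalSpace S}
    (hσ_dist : @LowerSemicontinuous (S × S) ℝ (@instTopologicalSpaceProd S S σ σ) _
      (fun p => dist p.1 p.2))
    {φ : ℝ → S → EReal} {a : ℝ → ℕ → ℝ} {u₀ : ℝ → ℝ → S} {p : S}
    (h : ExistenceAssumptions σ φ a u₀ p) {ε : ℝ} (hε : 0 < ε) (hbot : ∀ v, φ ε v ≠ ⊥) {x : S}
    (hx : φ ε x ≠ ⊤) {c : ℝ} (hc : 0 < c) : ∃ z, IsProx (φ ε) c x z := by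
  obtain ⟨B, hB⟩ := h.coercive (c / 4) (by positivity)
  set f := (φ ε x).toReal with hf
  -- On the sublevel set, coercivity with constant `c / 4` bounds the distance from `x`.
  set Q := 2 / c * (f - B + c / 2 * dist x p ^ 2) with hQ
  set R := |f| + 1 + (√(max Q 0) + dist x p + 1) with hR
  have hd0 : 0 ≤ dist x p := dist_nonneg
  have hRpos : 0 < R := by positivity
  obtain ⟨K, hK, hKmem⟩ := h.compact R hRpos
  refine @exists_forall_add_le S σ (φ ε) (fun v => c * dist v x ^ 2) (h.lsc ε hε)
    (@lowerSemicontinuous_mul_sq S σ _ hσ_dist (fun _ => dist_nonneg) c hc.le x) K hK x ?_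
  intro v hv
  have hvt : φ ε v ≠ ⊤ := by
    intro hvt
    rw [hvt, EReal.top_add_coe, top_le_iff] at hv
    exact EReal.add_ne_top hx (EReal.coe_ne_top _) hv
  have h1 : (φ ε v).toReal + c * dist v x ^ 2 ≤ f := by
    rw [← EReal.coe_toReal hvt (hbot v), ← EReal.coe_toReal hx (hbot x), dist_self] at hv
    have : (φ ε v).toReal + c * dist v x ^ 2 ≤ f + c * 0 ^ 2 := by exact_mod_cast hv
    linarith
  have h2 : B ≤ (φ ε v).toReal + c / 4 * dist v p ^ 2 := by
    have := hB ε hε v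
    rw [← EReal.coe_toReal hvt (hbot v)] at this
    exact_mod_cast this
  have h3 : dist v p ^ 2 ≤ 2 * dist v x ^ 2 + 2 * dist x p ^ 2 := by
    have : dist v p ^ 2 ≤ (dist v x + dist x p) ^ 2 := by gcongr; exact dist_triangle _ _ _
    nlinarith [sq_nonneg (dist v x - dist x p)]
  have h4 : dist v x ^ 2 ≤ Q := by
    have : c / 2 * dist v x ^ 2 ≤ f - B + c / 2 * dist x p ^ 2 := by nlinarith
    calc dist v x ^ 2 = 2 / c * (c / 2 * dist v x ^ 2) := by field_simp
      _ ≤ Q := by rw [hQ]; gcongr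
  have h5 : dist v x ≤ √(max Q 0) := Real.le_sqrt_of_sq_le (h4.trans (le_max_left _ _))
  refine hKmem ε hε v ?_ ?_
  · have := dist_triangle v x p
    have := abs_nonneg f
    linarith
  · rw [← EReal.coe_toReal hvt (hbot v)]
    have h6 : 0 ≤ c * dist v x ^ 2 := by positivity
    have h7 := le_abs_self f
    have h8 := Real.sqrt_nonneg (max Q 0)
    exact_mod_cast (by linarith : (φ ε v).toReal < R)

/-- Up to a fixed time, discrete solutions and their energies are bounded uniformly in the step and
in the functional. -/
theorem ExistenceAssumptions.exists_bounds {σ : TopologicalSpace S}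
    {φ : ℝ → S → EReal} {a : ℝ → ℕ → ℝ} {u₀ : ℝ → ℝ → S} {p : S}
    (h : ExistenceAssumptions σ φ a u₀ p) (hbot : ∀ ε, 0 < ε → ∀ v, φ ε v ≠ ⊥)
    (ha : ∀ τ, 0 < τ → ∀ n, 1 ≤ n → 0 < a τ n) {T : ℝ} (hT : 0 < T) :
    ∃ R, ∀ τ ε, 0 < τ → 0 < ε → ∀ w, IsDiscreteSolution (φ ε) τ (a τ) (u₀ τ ε) w →
      ∀ N : ℕ, N * τ ≤ T → dist (w N) p ≤ R ∧ |(φ ε (w N)).toReal| ≤ R := by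
  obtain ⟨-, -, C, hC⟩ := h.unifIntegrable T hT
  obtain ⟨C₀, hC₀⟩ := h.initial
  set M : ℝ := C + 1 with hMdef
  have hM : 0 < M := by positivity
  obtain ⟨B, hB⟩ := h.coercive (1 / (8 * M)) (by positivity)
  set Q := 4 * C₀ ^ 2 + 8 * M * (C₀ - B) with hQ
  refine ⟨√(max Q 0) + |C₀| + |B - 1 / (8 * M) * Q|, fun τ ε hτ hε w hw N hN => ?_⟩
  have hF0 : (φ ε (w 0)).toReal ≤ C₀ := by
    have := (hC₀ τ ε hτ hε).2
    rw [← hw.init, ← EReal.coe_toReal hw.init_dom (hbot ε hε _)] at this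
    exact_mod_cast this
  have hL : ∫ r in (0 : ℝ)..(N * τ), 1 / a τ ⌈r / τ⌉₊ ≤ M := by
    have h0 : (0 : ℝ) ≤ N * τ := by positivity
    have h1 := hC ⟨τ, hτ⟩
    rw [eLpNorm_one_eq_lintegral_enorm] at h1
    rw [intervalIntegral.integral_of_le h0]
    refine (le_abs_self _).trans ?_
    rw [← Real.norm_eq_abs, ← toReal_enorm]
    refine (ENNReal.toReal_le_of_le_ofReal NNReal.zero_le_coe
      (b := (C : ℝ)) ?_).trans (by linarith)
    rw [ENNReal.ofReal_coe_nnreal]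
    refine (enorm_integral_le_lintegral_enorm _).trans (le_trans ?_ h1)
    exact lintegral_mono_set (Ioc_subset_Icc_self.trans (Icc_subset_Icc_right hN))
  obtain ⟨h1, h2⟩ := hw.bounds (hbot ε hε) hτ (ha τ hτ) (p := p) (B := B) hM
    (by rw [hw.init]; exact (hC₀ τ ε hτ hε).1) hF0 (fun v hv => by
      have := hB ε hε v
      rw [← EReal.coe_toReal hv (hbot ε hε v)] at this
      exact_mod_cast this) hL
  have h3 : dist (w N) p ≤ √(max Q 0) := Real.le_sqrt_of_sq_le (h1.trans (le_max_left _ _))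
  have h4 := (hw.antitone (hbot ε hε) hτ (ha τ hτ) (Nat.zero_le N)).trans hF0
  dsimp only at h4
  have h5 := Real.sqrt_nonneg (max Q 0)
  have h6 := abs_nonneg C₀
  have h7 := abs_nonneg (B - 1 / (8 * M) * Q)
  refine ⟨by linarith, abs_le.2 ⟨?_, ?_⟩⟩
  · have := neg_abs_le (B - 1 / (8 * M) * Q)
    linarith
  · have := le_abs_self C₀
    linarith

end Apriori

/-! ### Passage to the limit -/

section Limit

variable {S : Type*} [MetricSpace S]

/-- A sequence of discrete solutions `w k` with variational interpolations `Z k` and slope bounds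
`H k`, converging to the curve `u`, together with the compactness that the limit passage rests on:
weak convergence of the weights `1 / a k` to `l`, uniform bounds, the Colombo-Gobbino conditions
along subsequences, and convergence of the discrete energies at positive rational times. -/
structure ConvergentScheme (σ : TopologicalSpace S) (φ : ℕ → S → EReal) (φlim : S → EReal)
    (a : ℕ → ℕ → ℝ) (τ : ℕ → ℝ) (w : ℕ → ℕ → S) (Z : ℕ → ℝ → S) (H : ℕ → ℝ → ℝ) (l : ℝ → ℝ)
    (u : ℝ → S) (p : S) : Prop where
  bot : ∀ k v, φ k v ≠ ⊥
  pos_step : ∀ k, 0 < τ k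
  step_tendsto : Tendsto τ atTop (𝓝 0)
  pos_coeff : ∀ k n, 1 ≤ n → 0 < a k n
  disc : ∀ k, IsDiscreteSolution (φ k) (τ k) (a k) (w k 0) (w k)
  interpolation : ∀ k, IsInterpolation (φ k) (τ k) (a k) (w k) (Z k) (H k)
  conv : ∀ t, 0 ≤ t → Tendsto (fun k => w k ⌈t / τ k⌉₊) atTop (@nhds S σ (u t))
  limit_pos : ∀ t, 0 < t → 0 < l t
  limit_integrable : ∀ T, 0 < T → IntervalIntegrable l volume 0 T
  integrable : ∀ k T, 0 < T → IntervalIntegrable (fun r => 1 / a k ⌈r / τ k⌉₊) volume 0 T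
  weak : ∀ s t, 0 < s → s < t → ∀ g : ℝ → ℝ, Measurable g → (∃ C : ℝ, ∀ x, |g x| ≤ C) →
    Tendsto (fun k => ∫ r in Icc s t, g r * (1 / a k ⌈r / τ k⌉₊)) atTop
      (𝓝 (∫ r in Icc s t, g r * l r))
  bounds : ∀ T, ∃ R, ∀ k, ∀ t ≤ T, dist (w k ⌈t / τ k⌉₊) p ≤ R ∧
    |(φ k (w k ⌈t / τ k⌉₊)).toReal| ≤ R
  compact : ∀ R : ℝ, ∃ K : Set S, @IsCompact S σ K ∧
    ∀ k v, dist v p < R → φ k v < (R : EReal) → v ∈ K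
  lower : ∀ R : ℝ, ∃ B : ℝ, ∀ k v, dist v p ≤ R → (B : EReal) ≤ φ k v
  slope_liminf : ∀ n : ℕ → ℕ, StrictMono n → ∀ (v : ℕ → S) (vlim : S),
    Tendsto v atTop (@nhds S σ vlim) →
    (∃ C : ℝ, ∀ j, ((-C : ℝ) : EReal) ≤ φ (n j) (v j) ∧ φ (n j) (v j) ≤ (C : EReal) ∧
      localSlope (φ (n j)) (v j) ≤ ENNReal.ofReal C) →
    Tendsto (fun j => φ (n j) (v j)) atTop (𝓝 (φlim vlim)) ∧
    localSlope φlim vlim ≤ liminf (fun j => localSlope (φ (n j)) (v j)) atTop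
  energy_conv : ∀ q : ℚ, 0 < q → ∃ c : ℝ,
    Tendsto (fun k => (φ k (w k ⌈(q : ℝ) / τ k⌉₊)).toReal) atTop (𝓝 c)

/-- The upper limit of the discrete energies at time `t`; it is the non-increasing representative
of the energy of the limit curve. -/
noncomputable def limitEnergy (φ : ℕ → S → EReal) (τ : ℕ → ℝ) (w : ℕ → ℕ → S) (t : ℝ) : ℝ :=
  limsup (fun k => (φ k (w k ⌈t / τ k⌉₊)).toReal) atTop

/-- The lower limit of the squared slope bounds. -/
noncomputable def limitSlopeSq (H : ℕ → ℝ → ℝ) (t : ℝ) : ℝ≥0∞ :=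
  liminf (fun k => ENNReal.ofReal (H k t) ^ 2) atTop

namespace ConvergentScheme

variable {σ : TopologicalSpace S} {φ : ℕ → S → EReal} {φlim : S → EReal} {a : ℕ → ℕ → ℝ}
  {τ : ℕ → ℝ} {w : ℕ → ℕ → S} {Z : ℕ → ℝ → S} {H : ℕ → ℝ → ℝ} {l : ℝ → ℝ} {u : ℝ → S} {p : S}

theorem antitone_energy (h : ConvergentScheme σ φ φlim a τ w Z H l u p) (k : ℕ) {s t : ℝ}
    (hst : s ≤ t) :
    (φ k (w k ⌈t / τ k⌉₊)).toReal ≤ (φ k (w k ⌈s / τ k⌉₊)).toReal := by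
  refine (h.disc k).antitone (h.bot k) (h.pos_step k) (h.pos_coeff k) (Nat.ceil_mono ?_)
  have := h.pos_step k
  gcongr

theorem isBoundedUnder_le (h : ConvergentScheme σ φ φlim a τ w Z H l u p) (t : ℝ) :
    IsBoundedUnder (· ≤ ·) atTop fun k => (φ k (w k ⌈t / τ k⌉₊)).toReal := by
  obtain ⟨R, hR⟩ := h.bounds t
  exact isBoundedUnder_of ⟨R, fun k => (abs_le.1 (hR k t le_rfl).2).2⟩

theorem isBoundedUnder_ge (h : ConvergentScheme σ φ φlim a τ w Z H l u p) (t : ℝ) :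
    IsBoundedUnder (· ≥ ·) atTop fun k => (φ k (w k ⌈t / τ k⌉₊)).toReal := by
  obtain ⟨R, hR⟩ := h.bounds t
  exact isBoundedUnder_of ⟨-R, fun k => (abs_le.1 (hR k t le_rfl).2).1⟩

theorem antitone_limitEnergy (h : ConvergentScheme σ φ φlim a τ w Z H l u p) :
    Antitone (limitEnergy φ τ w) := fun s t hst =>
  limsup_le_limsup (Eventually.of_forall fun k => h.antitone_energy k hst)
    (h.isBoundedUnder_ge t).isCoboundedUnder_le (h.isBoundedUnder_le s)

theorem tendsto_limitEnergy (h : ConvergentScheme σ φ φlim a τ w Z H l u p) {q : ℚ} (hq : 0 < q) :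
    Tendsto (fun k => (φ k (w k ⌈(q : ℝ) / τ k⌉₊)).toReal) atTop (𝓝 (limitEnergy φ τ w q)) := by
  obtain ⟨c, hc⟩ := h.energy_conv q hq
  rwa [limitEnergy, hc.limsup_eq]

theorem intervalIntegrable_limit (h : ConvergentScheme σ φ φlim a τ w Z H l u p) {s t : ℝ}
    (hs : 0 ≤ s) (ht : 0 ≤ t) : IntervalIntegrable l volume s t := by
  have : ∀ r, 0 ≤ r → IntervalIntegrable l volume 0 r := fun r hr => by
    rcases hr.eq_or_lt with rfl | hr
    · simp
    · exact h.limit_integrable r hr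
  exact (this s hs).symm.trans (this t ht)

/-- The integrals of the weights over all subintervals of `[s, t]` are bounded simultaneously, so
that the endpoints may depend on the step. -/
theorem eventually_integral_le (h : ConvergentScheme σ φ φlim a τ w Z H l u p) {s t η : ℝ}
    (hs : 0 < s) (hst : s < t) (hη : 0 < η) :
    ∀ᶠ k in atTop, ∀ x y, s ≤ x → x ≤ y → y ≤ t →
      ∫ r in x..y, 1 / a k ⌈r / τ k⌉₊ ≤ (∫ r in s..t, l r) + η := by
  have hw := h.weak s t hs hst (fun _ => 1) measurable_const ⟨1, fun _ => by simp⟩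
  simp only [one_mul] at hw
  rw [integral_Icc_eq_integral_Ioc, ← intervalIntegral.integral_of_le hst.le] at hw
  filter_upwards [hw.eventually (gt_mem_nhds (lt_add_of_pos_right _ hη))] with k hk x y hx hxy hy
  rw [integral_Icc_eq_integral_Ioc, ← intervalIntegral.integral_of_le hst.le] at hk
  refine le_trans ?_ hk.le
  refine intervalIntegral.integral_mono_interval hx hxy hy ?_ ?_
  · refine (ae_restrict_iff' measurableSet_Ioc).2 (Eventually.of_forall fun r hr => ?_)
    have : 0 < a k ⌈r / τ k⌉₊ :=
      h.pos_coeff k _ (Nat.ceil_pos.2 (div_pos (hs.trans hr.1) (h.pos_step k)))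
    rw [Pi.zero_apply]
    positivity
  · refine (h.integrable k t (hs.trans hst)).mono_set ?_
    rw [uIcc_of_le hst.le, uIcc_of_le (hs.trans hst).le]
    exact Icc_subset_Icc_left hs.le

theorem exists_integral_lt (h : ConvergentScheme σ φ φlim a τ w Z H l u p) {t η : ℝ}
    (ht : 0 < t) (hη : 0 < η) : ∃ s t', 0 < s ∧ s < t ∧ t < t' ∧ ∫ r in s..t', l r < η := by
  have hint : IntegrableOn l (uIcc 0 (2 * t)) := by
    rw [uIcc_of_le (by linarith), integrableOn_Icc_iff_integrableOn_Ioc,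
      ← intervalIntegrable_iff_integrableOn_Ioc_of_le (by linarith)]
    exact h.limit_integrable _ (by linarith)
  have hc := intervalIntegral.continuousOn_primitive_interval hint
  rw [uIcc_of_le (by linarith)] at hc
  have hc' : ContinuousAt (fun x => ∫ r in (0 : ℝ)..x, l r) t :=
    hc.continuousAt (Icc_mem_nhds ht (by linarith))
  have hev : ∀ᶠ x in 𝓝 t, |(∫ r in (0 : ℝ)..x, l r) - ∫ r in (0 : ℝ)..t, l r| < η / 2 := by
    have := Metric.tendsto_nhds.1 hc' (η / 2) (by positivity)
    simpa [Real.dist_eq] using this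
  obtain ⟨δ, hδ, hball⟩ := Metric.eventually_nhds_iff.1 hev
  set ρ := min (δ / 2) (t / 2) with hρ
  have hρ0 : 0 < ρ := by positivity
  have hρt : ρ ≤ t / 2 := min_le_right _ _
  have hρδ : ρ ≤ δ / 2 := min_le_left _ _
  refine ⟨t - ρ, t + ρ, by linarith, by linarith, by linarith, ?_⟩
  have h1 := hball (y := t - ρ) (by
    rw [Real.dist_eq, sub_sub_cancel_left, abs_neg, abs_of_pos hρ0]; linarith)
  have h2 := hball (y := t + ρ) (by
    rw [Real.dist_eq, add_sub_cancel_left, abs_of_pos hρ0]; linarith)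
  rw [← intervalIntegral.integral_interval_sub_left
    (h.intervalIntegrable_limit le_rfl (by linarith))
    (h.intervalIntegrable_limit le_rfl (by linarith))]
  linarith [(abs_lt.1 h1).1, (abs_lt.1 h2).2]

theorem step_bounds (h : ConvergentScheme σ φ φlim a τ w Z H l u p) {t : ℝ} {R : ℝ}
    (hR : ∀ k, ∀ s ≤ t, dist (w k ⌈s / τ k⌉₊) p ≤ R ∧ |(φ k (w k ⌈s / τ k⌉₊)).toReal| ≤ R)
    {k n : ℕ} (hn : ⌈t / τ k⌉₊ = n + 1) :
    dist (w k n) p ≤ R ∧ |(φ k (w k n)).toReal| ≤ R := by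
  have hτ := h.pos_step k
  have := hR k (n * τ k) (mem_Ioc_of_ceil_div_eq hτ hn).1.le
  rwa [mul_div_cancel_right₀ _ hτ.ne', Nat.ceil_natCast] at this

/-- The jump of the discrete solutions at a given time vanishes in the limit, since its square is
at most a constant times the integral of the weight over one step. -/
theorem eventually_step_lt (h : ConvergentScheme σ φ φlim a τ w Z H l u p) {t δ : ℝ}
    (ht : 0 < t) (hδ : 0 < δ) : ∀ᶠ k in atTop, ∀ n, ⌈t / τ k⌉₊ = n + 1 →
      dist (w k n) (w k (n + 1)) < δ := by
  obtain ⟨R, hR⟩ := h.bounds t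
  have hR0 : 0 ≤ R := dist_nonneg.trans (hR 0 t le_rfl).1
  set η := δ ^ 2 / (4 * R + 1) / 2 with hη
  have hη0 : 0 < η := by positivity
  obtain ⟨s, t', hs, hst, htt', hint⟩ := h.exists_integral_lt ht hη0
  filter_upwards [h.eventually_integral_le hs (hst.trans htt') hη0,
    h.step_tendsto.eventually (gt_mem_nhds (sub_pos.2 hst)),
    h.step_tendsto.eventually (gt_mem_nhds (sub_pos.2 htt'))] with k hk h1 h2 n hn
  have hmem := mem_Ioc_of_ceil_div_eq (h.pos_step k) hn
  have hτ := h.pos_step k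
  have hI := hk (n * τ k) ((n + 1 : ℕ) * τ k) (by linarith [hmem.2]) (by gcongr; simp)
    (by push_cast; linarith [hmem.1])
  have hE := ((h.interpolation k).energy_inequality (h.bot k) hτ (h.pos_coeff k) (h.disc k)
    (Nat.le_succ n) (e := 0) (by simp)).2
  have hb1 := (abs_le.1 (h.step_bounds hR hn).2).2
  have hb2 := (abs_le.1 (hR k t le_rfl).2).1
  rw [hn] at hb2
  have hI0 : 0 ≤ ∫ r in (n * τ k)..((n + 1 : ℕ) * τ k), 1 / a k ⌈r / τ k⌉₊ := by
    rw [integral_interp hτ (Nat.le_succ n)]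
    exact Finset.sum_nonneg fun i _ => by have := h.pos_coeff k (i + 1) (by simp); positivity
  have : dist (w k n) (w k (n + 1)) ^ 2 < δ ^ 2 := by
    calc dist (w k n) (w k (n + 1)) ^ 2 ≤ _ := hE
      _ ≤ (4 * R) * (∫ r in (n * τ k)..((n + 1 : ℕ) * τ k), 1 / a k ⌈r / τ k⌉₊) := by
        gcongr
        rw [Nat.succ_eq_add_one]
        linarith
      _ ≤ (4 * R) * (2 * η) := by gcongr; linarith
      _ < (4 * R + 1) * (2 * η) := by gcongr; linarith
      _ = δ ^ 2 := by rw [hη]; field_simp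
  exact lt_of_pow_lt_pow_left₀ 2 hδ.le this

/-- The variational interpolants stay in a compact set and converge to the same limit as the
discrete solutions. -/
theorem tendsto_interpolation
    (hσ_dist : @LowerSemicontinuous (S × S) ℝ (@instTopologicalSpaceProd S S σ σ) _
      (fun p => dist p.1 p.2))
    (h : ConvergentScheme σ φ φlim a τ w Z H l u p) {t : ℝ} (ht : 0 < t) :
    (∃ R, ∀ k, dist (Z k t) p ≤ R ∧ φ k (Z k t) ≤ (R : EReal)) ∧
    Tendsto (fun k => Z k t) atTop (@nhds S σ (u t)) := by
  have hpos : ∀ k, ∃ n, ⌈t / τ k⌉₊ = n + 1 := fun k =>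
    Nat.exists_eq_succ_of_ne_zero (Nat.ceil_pos.2 (div_pos ht (h.pos_step k))).ne'
  obtain ⟨R, hR⟩ := h.bounds t
  have hR0 : 0 ≤ R := dist_nonneg.trans (hR 0 t le_rfl).1
  have hbd : ∀ k, dist (Z k t) p ≤ 3 * R ∧ φ k (Z k t) ≤ ((3 * R : ℝ) : EReal) := by
    intro k
    obtain ⟨n, hn⟩ := hpos k
    have h1 := (h.interpolation k).dist_le t n hn
    have h2 := h.step_bounds hR hn
    have h3 := hR k t le_rfl
    rw [hn] at h3
    constructor
    · have h4 := dist_triangle (Z k t) (w k n) p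
      have h5 := dist_triangle_right (w k (n + 1)) (w k n) p
      linarith
    · rw [← EReal.coe_toReal ((h.interpolation k).ne_top t) (h.bot k _)]
      have h4 := ((h.interpolation k).value_mem t n hn).2
      have h5 := (abs_le.1 h2.2).2
      exact_mod_cast (by linarith : (φ k (Z k t)).toReal ≤ 3 * R)
  refine ⟨⟨3 * R, hbd⟩, ?_⟩
  obtain ⟨K, hK, hmem⟩ := h.compact (3 * R + 1)
  refine @tendsto_of_dist_tendsto_zero S σ (fun p => dist p.1 p.2) hσ_dist
    (fun x y hxy => dist_le_zero.1 hxy) K hK (fun k => Z k t) (fun k => w k ⌈t / τ k⌉₊) (u t)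
    (Eventually.of_forall fun k => ?_) (h.conv t ht.le) ?_
  · refine hmem k _ (by linarith [(hbd k).1]) ((hbd k).2.trans_lt ?_)
    exact_mod_cast (by linarith : 3 * R < 3 * R + 1)
  · rw [Metric.tendsto_nhds]
    intro δ hδ
    filter_upwards [h.eventually_step_lt ht (half_pos hδ)] with k hk
    obtain ⟨n, hn⟩ := hpos k
    have h1 := hk n hn
    have h2 := (h.interpolation k).dist_le t n hn
    rw [dist_comm (w k (n + 1))] at h2
    rw [Real.dist_0_eq_abs, abs_of_nonneg dist_nonneg, hn]
    have := dist_triangle (Z k t) (w k n) (w k (n + 1))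
    linarith

/-- Along a subsequence on which the slope bounds stay bounded at time `t`, the energies of the
interpolants converge to the energy of `u t`, which is thereby squeezed between the values of the
limit energy at earlier and later rational times. -/
theorem limit_at_of_frequently
    (hσ_dist : @LowerSemicontinuous (S × S) ℝ (@instTopologicalSpaceProd S S σ σ) _
      (fun p => dist p.1 p.2))
    (h : ConvergentScheme σ φ φlim a τ w Z H l u p) {t C : ℝ} (ht : 0 < t) (hC0 : 0 ≤ C)
    (hC : ∃ᶠ k in atTop, H k t ≤ C) :
    localSlope φlim (u t) ≤ ENNReal.ofReal C ∧ ∃ y : ℝ, φlim (u t) = (y : EReal) ∧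
      (∀ q : ℚ, 0 < q → (q : ℝ) < t → y ≤ limitEnergy φ τ w q) ∧
      (∀ q : ℚ, t < (q : ℝ) → limitEnergy φ τ w q ≤ y) := by
  have hpos : ∀ k, ∃ n, ⌈t / τ k⌉₊ = n + 1 := fun k =>
    Nat.exists_eq_succ_of_ne_zero (Nat.ceil_pos.2 (div_pos ht (h.pos_step k))).ne'
  obtain ⟨n, hn, hnC⟩ := extraction_of_frequently_atTop hC
  obtain ⟨⟨R, hR⟩, hlim⟩ := h.tendsto_interpolation hσ_dist ht
  obtain ⟨B, hB⟩ := h.lower R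
  have hslope : ∀ j, localSlope (φ (n j)) (Z (n j) t) ≤ ENNReal.ofReal C := fun j =>
    ((h.interpolation (n j)).slope_le t ht).trans (ENNReal.ofReal_le_ofReal (hnC j))
  have hlow : ∀ j, (B : EReal) ≤ φ (n j) (Z (n j) t) := fun j => hB _ _ (hR _).1
  have hBC : -(|B| + |R| + C) ≤ B := by linarith [neg_abs_le B, abs_nonneg R]
  have hRC : R ≤ |B| + |R| + C := by linarith [le_abs_self R, abs_nonneg B]
  have hCC : C ≤ |B| + |R| + C := by linarith [abs_nonneg R, abs_nonneg B]
  obtain ⟨h1, h2⟩ := h.slope_liminf n hn (fun j => Z (n j) t) (u t) (hlim.comp hn.tendsto_atTop)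
    ⟨|B| + |R| + C, fun j => ⟨le_trans (EReal.coe_le_coe_iff.2 hBC) (hlow j),
      (hR _).2.trans (EReal.coe_le_coe_iff.2 hRC),
      (hslope j).trans (ENNReal.ofReal_le_ofReal hCC)⟩⟩
  refine ⟨h2.trans (liminf_le_of_frequently_le' (Frequently.of_forall hslope)), ?_⟩
  have hge : (B : EReal) ≤ φlim (u t) := ge_of_tendsto' h1 hlow
  have hle : φlim (u t) ≤ (R : EReal) := le_of_tendsto' h1 fun j => (hR _).2
  have hy : φlim (u t) = ((φlim (u t)).toReal : EReal) :=
    (EReal.coe_toReal (ne_top_of_le_ne_top (EReal.coe_ne_top R) hle)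
      (ne_bot_of_le_ne_bot (EReal.coe_ne_bot B) hge)).symm
  have hZ : ∀ j, φ (n j) (Z (n j) t) = ((φ (n j) (Z (n j) t)).toReal : EReal) := fun j =>
    (EReal.coe_toReal ((h.interpolation _).ne_top t) (h.bot _ _)).symm
  rw [hy, funext hZ] at h1
  have h1' := EReal.tendsto_coe.1 h1
  refine ⟨_, hy, fun q hq hqt => ?_, fun q hqt => ?_⟩
  · refine le_of_tendsto_of_tendsto h1' ((h.tendsto_limitEnergy hq).comp hn.tendsto_atTop) ?_
    filter_upwards [(h.step_tendsto.comp hn.tendsto_atTop).eventually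
      (gt_mem_nhds (sub_pos.2 hqt))] with j hj
    obtain ⟨i, hi⟩ := hpos (n j)
    refine ((h.interpolation (n j)).value_mem t i hi).2.trans ?_
    have hτ := h.pos_step (n j)
    refine (h.disc _).antitone (h.bot _) hτ (h.pos_coeff _) (Nat.ceil_le.2 ?_)
    rw [div_le_iff₀ hτ]
    have := (mem_Ioc_of_ceil_div_eq hτ hi).2
    have hj' : τ (n j) < t - q := hj
    linarith
  · have hq : 0 < q := by exact_mod_cast ht.trans hqt
    refine le_of_tendsto_of_tendsto ((h.tendsto_limitEnergy hq).comp hn.tendsto_atTop) h1' ?_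
    refine Eventually.of_forall fun j => ?_
    obtain ⟨i, hi⟩ := hpos (n j)
    refine le_trans ?_ ((h.interpolation (n j)).value_mem t i hi).1
    rw [← hi]
    exact h.antitone_energy (n j) hqt.le

/-- At every positive time the lower limit of the slope bounds dominates the slope of the limit
functional; where it is finite, the energy of `u t` is squeezed by the limit energy. -/
theorem limit_at
    (hσ_dist : @LowerSemicontinuous (S × S) ℝ (@instTopologicalSpaceProd S S σ σ) _
      (fun p => dist p.1 p.2))
    (h : ConvergentScheme σ φ φlim a τ w Z H l u p) {t : ℝ} (ht : 0 < t) :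
    localSlope φlim (u t) ^ 2 ≤ limitSlopeSq H t ∧
    (limitSlopeSq H t ≠ ⊤ → ∃ y : ℝ, φlim (u t) = (y : EReal) ∧
      (∀ q : ℚ, 0 < q → (q : ℝ) < t → y ≤ limitEnergy φ τ w q) ∧
      (∀ q : ℚ, t < (q : ℝ) → limitEnergy φ τ w q ≤ y)) := by
  have key : ∀ c : ℝ≥0∞, limitSlopeSq H t < c → c ≠ ⊤ → ∃ᶠ k in atTop, H k t ≤ √c.toReal := by
    intro c hc hct
    refine (frequently_lt_of_liminf_lt (by isBoundedDefault) hc).mono fun k hk => ?_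
    rcases le_total (H k t) 0 with h0 | h0
    · exact h0.trans (Real.sqrt_nonneg _)
    refine Real.le_sqrt_of_sq_le ?_
    rw [← ENNReal.ofReal_pow h0] at hk
    exact ((ENNReal.ofReal_lt_iff_lt_toReal (sq_nonneg _) hct).1 hk).le
  constructor
  · refine le_of_forall_gt fun c hc => ?_
    obtain ⟨c', hc1, hc2⟩ := exists_between hc
    have hct := hc2.ne_top
    have h1 := (h.limit_at_of_frequently hσ_dist ht (Real.sqrt_nonneg _) (key c' hc1 hct)).1
    refine lt_of_le_of_lt ?_ hc2
    calc localSlope φlim (u t) ^ 2 ≤ ENNReal.ofReal √c'.toReal ^ 2 := by gcongr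
      _ = c' := by
        rw [← ENNReal.ofReal_pow (Real.sqrt_nonneg _), Real.sq_sqrt ENNReal.toReal_nonneg,
          ENNReal.ofReal_toReal hct]
  · intro hfin
    obtain ⟨c, hc1, hc2⟩ := exists_between (lt_top_iff_ne_top.2 hfin)
    exact (h.limit_at_of_frequently hσ_dist ht (Real.sqrt_nonneg _) (key c hc1 hc2.ne)).2

/-! ### The energy inequality in the limit -/

theorem measurable_limitSlopeSq (h : ConvergentScheme σ φ φlim a τ w Z H l u p) :
    Measurable (limitSlopeSq H) :=
  Measurable.liminf fun k => (h.interpolation k).measurable.ennreal_ofReal.pow_const 2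

/-- If the dissipation by slope in `(s, t)` is eventually at least `e` along the discrete solutions,
the discrete energy inequality passes to the limit with `e` in its place. -/
theorem energy_inequality_of_eventually
    (hσ_dist : @LowerSemicontinuous (S × S) ℝ (@instTopologicalSpaceProd S S σ σ) _
      (fun p => dist p.1 p.2))
    (h : ConvergentScheme σ φ φlim a τ w Z H l u p) {s t e : ℝ} (hs : 0 < s) (hst : s < t)
    (he : ∀ᶠ k in atTop, ENNReal.ofReal e ≤
      ∫⁻ r in Ioc (⌈s / τ k⌉₊ * τ k) (⌈t / τ k⌉₊ * τ k),
        ENNReal.ofReal (1 / a k ⌈r / τ k⌉₊) * ENNReal.ofReal (H k r) ^ 2) :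
    e ≤ 2 * (limitEnergy φ τ w s - limitEnergy φ τ w t) ∧
    dist (u s) (u t) ^ 2 ≤
      (2 * (limitEnergy φ τ w s - limitEnergy φ τ w t) - e) * ∫ r in s..t, l r := by
  set X := 2 * (limitEnergy φ τ w s - limitEnergy φ τ w t) with hX
  set L := ∫ r in s..t, l r with hL
  have ht := hs.trans hst
  have main : ∀ δ : ℝ, 0 < δ → e ≤ X + 4 * δ ∧
      max (dist (u s) (u t) - δ) 0 ^ 2 ≤ (X + 4 * δ - e) * (L + 2 * δ) := by
    intro δ hδ
    obtain ⟨s₀, t', hs₀, hs₀t, htt', hint⟩ := h.exists_integral_lt ht hδ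
    have hLt : ∫ r in s..t', l r ≤ L + δ := by
      rw [← intervalIntegral.integral_add_adjacent_intervals
        (h.intervalIntegrable_limit hs.le ht.le)
        (h.intervalIntegrable_limit ht.le (ht.trans htt').le)]
      have : ∫ r in t..t', l r ≤ ∫ r in s₀..t', l r := by
        refine intervalIntegral.integral_mono_interval hs₀t.le htt'.le le_rfl ?_
          (h.intervalIntegrable_limit hs₀.le (ht.trans htt').le)
        exact (ae_restrict_iff' measurableSet_Ioc).2
          (Eventually.of_forall fun r hr => (h.limit_pos r (hs₀.trans hr.1)).le)
      linarith
    have ev1 := @eventually_sub_lt_of_tendsto S σ (fun p => dist p.1 p.2) ℕ atTop hσ_dist _ _ _ _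
      (h.conv s hs.le) (h.conv t ht.le) δ hδ
    have ev2 := eventually_lt_of_limsup_lt (lt_add_of_pos_right (limitEnergy φ τ w s) hδ)
      (h.isBoundedUnder_le s)
    have fr := frequently_lt_of_lt_limsup (h.isBoundedUnder_ge t).isCoboundedUnder_le
      (sub_lt_self (limitEnergy φ τ w t) hδ)
    obtain ⟨k, hk, hek, hdk, hsk, hIk, hτk⟩ := (fr.and_eventually (he.and (ev1.and (ev2.and
      ((h.eventually_integral_le hs (hst.trans htt') hδ).and
        (h.step_tendsto.eventually (gt_mem_nhds (sub_pos.2 htt')))))))).exists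
    have hτ := h.pos_step k
    have hmN : ⌈s / τ k⌉₊ ≤ ⌈t / τ k⌉₊ := Nat.ceil_mono (by gcongr)
    obtain ⟨h1, h2⟩ := (h.interpolation k).energy_inequality (h.bot k) hτ (h.pos_coeff k)
      (h.disc k) hmN hek
    have hXk : 2 * ((φ k (w k ⌈s / τ k⌉₊)).toReal - (φ k (w k ⌈t / τ k⌉₊)).toReal) ≤
        X + 4 * δ := by linarith
    have hsc : s ≤ ⌈s / τ k⌉₊ * τ k := by
      rw [← div_le_iff₀ hτ]; exact Nat.le_ceil _
    have htc : ⌈t / τ k⌉₊ * τ k ≤ t' := by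
      have := Nat.ceil_lt_add_one (div_pos ht hτ).le
      have := mul_lt_mul_of_pos_right this hτ
      rw [add_mul, div_mul_cancel₀ _ hτ.ne', one_mul] at this
      linarith
    have hI := hIk _ _ hsc (by gcongr) htc
    refine ⟨by linarith, ?_⟩
    have hL0 : 0 ≤ ∫ r in (⌈s / τ k⌉₊ * τ k)..(⌈t / τ k⌉₊ * τ k), 1 / a k ⌈r / τ k⌉₊ := by
      rw [integral_interp hτ hmN]
      exact Finset.sum_nonneg fun i _ => by have := h.pos_coeff k (i + 1) (by simp); positivity
    calc max (dist (u s) (u t) - δ) 0 ^ 2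
        ≤ dist (w k ⌈s / τ k⌉₊) (w k ⌈t / τ k⌉₊) ^ 2 := by
          gcongr
          exact max_le hdk.le dist_nonneg
      _ ≤ _ := h2
      _ ≤ _ := by
          gcongr
          · linarith
          · linarith
  have hlim : ∀ f : ℝ → ℝ, Continuous f → Tendsto f (𝓝[>] 0) (𝓝 (f 0)) := fun f hf =>
    (hf.tendsto 0).mono_left nhdsWithin_le_nhds
  have hpos : ∀ᶠ δ : ℝ in 𝓝[>] 0, 0 < δ := self_mem_nhdsWithin
  constructor
  · have := ge_of_tendsto (hlim (fun δ => X + 4 * δ) (by fun_prop))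
      (hpos.mono fun δ hδ => (main δ hδ).1)
    simpa using this
  · have := le_of_tendsto_of_tendsto (hlim (fun δ => max (dist (u s) (u t) - δ) 0 ^ 2)
      (by fun_prop)) (hlim (fun δ => (X + 4 * δ - e) * (L + 2 * δ)) (by fun_prop))
      (hpos.mono fun δ hδ => (main δ hδ).2)
    simpa using this

/-- The dissipation by slope is lower semicontinuous. -/
theorem eventually_lt_lintegral (h : ConvergentScheme σ φ φlim a τ w Z H l u p) {s t : ℝ}
    {e : ℝ≥0∞} (hs : 0 < s)
    (he : e < ∫⁻ r in Ioc s t, ENNReal.ofReal (l r) * limitSlopeSq H r) :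
    ∀ᶠ k in atTop, e < ∫⁻ r in Ioc (⌈s / τ k⌉₊ * τ k) (⌈t / τ k⌉₊ * τ k),
        ENNReal.ofReal (1 / a k ⌈r / τ k⌉₊) * ENNReal.ofReal (H k r) ^ 2 := by
  have hU : Ioc s t = ⋃ n : ℕ, Ioc (s + 1 / (n + 1)) t := by
    ext r
    simp only [mem_Ioc, mem_iUnion]
    constructor
    · rintro ⟨h1, h2⟩
      obtain ⟨n, hn⟩ := exists_nat_one_div_lt (sub_pos.2 h1)
      exact ⟨n, by linarith, h2⟩
    · rintro ⟨n, h1, h2⟩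
      have : (0 : ℝ) < 1 / (n + 1) := by positivity
      exact ⟨by linarith, h2⟩
  have hdir : Directed (· ⊆ ·) fun n : ℕ => Ioc (s + 1 / ((n : ℝ) + 1)) t := by
    refine Monotone.directed_le (f := fun n : ℕ => Ioc (s + 1 / ((n : ℝ) + 1)) t)
      fun n m hnm => Ioc_subset_Ioc_left ?_
    gcongr
  rw [hU, setLIntegral_iUnion_of_directed _ hdir] at he
  obtain ⟨n, hn⟩ := lt_iSup_iff.1 he
  set s' := s + 1 / ((n : ℝ) + 1) with hs'
  have hss' : s < s' := by rw [hs']; linarith [show (0 : ℝ) < 1 / ((n : ℝ) + 1) by positivity]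
  have hs't : s' < t := by
    by_contra! hcon
    rw [Ioc_eq_empty (not_lt.2 hcon)] at hn
    simp at hn
  have hs'0 := hs.trans hss'
  rw [setLIntegral_congr Ioc_ae_eq_Icc] at hn
  have hint : ∀ f : ℝ → ℝ, IntervalIntegrable f volume s' t → IntegrableOn f (Icc s' t) :=
    fun f hf => (intervalIntegrable_iff_integrableOn_Icc_of_le hs't.le).1 hf
  have hlsc := lintegral_mul_liminf_le (μ := volume.restrict (Icc s' t))
    (l := fun k r => 1 / a k ⌈r / τ k⌉₊) (l₀ := l) (H := fun k r => ENNReal.ofReal (H k r) ^ 2)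
    (fun k => hint _ (((h.integrable k t (hs'0.trans hs't))).mono_set (by
      rw [uIcc_of_le hs't.le, uIcc_of_le (hs'0.trans hs't).le]
      exact Icc_subset_Icc_left hs'0.le)))
    (hint _ (h.intervalIntegrable_limit hs'0.le (hs'0.trans hs't).le))
    (fun k => (ae_restrict_iff' measurableSet_Icc).2 (Eventually.of_forall fun r hr => by
      have : 0 < a k ⌈r / τ k⌉₊ :=
        h.pos_coeff k _ (Nat.ceil_pos.2 (div_pos (hs'0.trans_le hr.1) (h.pos_step k)))
      rw [Pi.zero_apply]
      positivity))
    ((ae_restrict_iff' measurableSet_Icc).2 (Eventually.of_forall fun r hr =>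
      (h.limit_pos r (hs'0.trans_le hr.1)).le))
    (fun k => (h.interpolation k).measurable.ennreal_ofReal.pow_const 2)
    (h.weak s' t hs'0 hs't)
  filter_upwards [eventually_lt_of_lt_liminf (hn.trans_le hlsc),
    h.step_tendsto.eventually (gt_mem_nhds (sub_pos.2 hss'))] with k hk hτk
  refine hk.trans_le ?_
  rw [← setLIntegral_congr Ioc_ae_eq_Icc]
  have hτ := h.pos_step k
  refine lintegral_mono_set (Ioc_subset_Ioc ?_ ?_)
  · have := Nat.ceil_lt_add_one (div_pos hs hτ).le
    have := mul_lt_mul_of_pos_right this hτ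
    rw [add_mul, div_mul_cancel₀ _ hτ.ne', one_mul] at this
    linarith
  · rw [← div_le_iff₀ hτ]; exact Nat.le_ceil _

/-- The limit of the discrete energy inequality; its kinetic term is still expressed through the
squared displacement. -/
theorem energy_inequality
    (hσ_dist : @LowerSemicontinuous (S × S) ℝ (@instTopologicalSpaceProd S S σ σ) _
      (fun p => dist p.1 p.2))
    (h : ConvergentScheme σ φ φlim a τ w Z H l u p) {s t : ℝ} (hs : 0 < s) (hst : s < t) :
    ∫⁻ r in Ioc s t, ENNReal.ofReal (l r) * limitSlopeSq H r ≤
      ENNReal.ofReal (2 * (limitEnergy φ τ w s - limitEnergy φ τ w t)) ∧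
    dist (u s) (u t) ^ 2 ≤ (2 * (limitEnergy φ τ w s - limitEnergy φ τ w t) -
      (∫⁻ r in Ioc s t, ENNReal.ofReal (l r) * limitSlopeSq H r).toReal) * ∫ r in s..t, l r := by
  set J := ∫⁻ r in Ioc s t, ENNReal.ofReal (l r) * limitSlopeSq H r with hJ
  set X := 2 * (limitEnergy φ τ w s - limitEnergy φ τ w t) with hX
  have key : ∀ e : ℝ, ENNReal.ofReal e < J → e ≤ X ∧
      dist (u s) (u t) ^ 2 ≤ (X - e) * ∫ r in s..t, l r := fun e he =>
    h.energy_inequality_of_eventually hσ_dist hs hst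
      ((h.eventually_lt_lintegral hs he).mono fun k hk => hk.le)
  have hJX : J ≤ ENNReal.ofReal X := by
    refine le_of_forall_lt fun c hc => ?_
    obtain ⟨c', hc1, hc2⟩ := exists_between hc
    have := (key c'.toReal (by rwa [ENNReal.ofReal_toReal hc2.ne_top])).1
    refine hc1.trans_le ?_
    rw [← ENNReal.ofReal_toReal hc2.ne_top]
    exact ENNReal.ofReal_le_ofReal this
  refine ⟨hJX, ?_⟩
  rcases eq_or_ne J 0 with h0 | h0
  · have := (h.energy_inequality_of_eventually hσ_dist hs hst (e := 0) (by simp)).2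
    rwa [h0, ENNReal.toReal_zero]
  have hJt : J ≠ ⊤ := ne_top_of_le_ne_top ENNReal.ofReal_ne_top hJX
  have hlim : Tendsto (fun e => (X - e) * ∫ r in s..t, l r) (𝓝[<] J.toReal)
      (𝓝 ((X - J.toReal) * ∫ r in s..t, l r)) :=
    (Continuous.tendsto (by fun_prop) _).mono_left nhdsWithin_le_nhds
  refine ge_of_tendsto hlim ?_
  filter_upwards [self_mem_nhdsWithin] with e he
  refine (key e ?_).2
  rw [← ENNReal.ofReal_toReal hJt]
  exact (ENNReal.ofReal_lt_ofReal_iff (ENNReal.toReal_pos h0 hJt)).2 he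

/-- The dissipation by slope is dropped here, so that the estimate reaches down to time `0`: the
limit energy is bounded there, and `l` is integrable. -/
theorem isAC
    (hσ_dist : @LowerSemicontinuous (S × S) ℝ (@instTopologicalSpaceProd S S σ σ) _
      (fun p => dist p.1 p.2))
    (h : ConvergentScheme σ φ φlim a τ w Z H l u p) {T : ℝ} (hT : 0 < T) : IsAC u 0 T := by
  have hk : Monotone fun r => -limitEnergy φ τ w r := h.antitone_limitEnergy.neg
  refine ⟨fun r => deriv (fun r => -limitEnergy φ τ w r) r + l r / 2, ?_, ?_⟩
  · refine (((intervalIntegrable_iff_integrableOn_Ioc_of_le hT.le).1 ?_)).mono_set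
      Ioo_subset_Ioc_self
    exact (hk.monotoneOn _).intervalIntegrable_deriv.add ((h.limit_integrable T hT).div_const 2)
  · intro s t hs hst ht
    refine dist_le_integral_of_dist_sq_le hst (hk.monotoneOn _)
      (h.intervalIntegrable_limit hs.le (hs.le.trans hst))
      (fun r hr => (h.limit_pos r (hs.trans_le hr.1)).le) fun r hr r' hr' hrr => ?_
    rcases hrr.eq_or_lt with rfl | hlt
    · simp
    refine (h.energy_inequality hσ_dist (hs.trans_le hr.1) hlt).2.trans ?_
    have h0 : 0 ≤ ∫ x in r..r', l x := intervalIntegral.integral_nonneg hrr fun x hx =>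
      (h.limit_pos x (hs.trans_le (hr.1.trans hx.1))).le
    gcongr
    have := ENNReal.toReal_nonneg
      (a := ∫⁻ x in Ioc r r', ENNReal.ofReal (l x) * limitSlopeSq H x)
    linarith

theorem dissipation_le
    (hσ_dist : @LowerSemicontinuous (S × S) ℝ (@instTopologicalSpaceProd S S σ σ) _
      (fun p => dist p.1 p.2))
    (h : ConvergentScheme σ φ φlim a τ w Z H l u p) {s t : ℝ} (hs : 0 < s) (hst : s < t) :
    (1 / 2) * (∫⁻ r in Ioo s t, ENNReal.ofReal (1 / l r) * metricDeriv u r ^ 2) +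
        (1 / 2) * (∫⁻ r in Ioo s t, ENNReal.ofReal (l r) * localSlope φlim (u r) ^ 2)
      ≤ ENNReal.ofReal (limitEnergy φ τ w s - limitEnergy φ τ w t) := by
  set J : ℝ → ℝ → ℝ≥0∞ := fun r r' =>
    ∫⁻ x in Ioc r r', ENNReal.ofReal (l x) * limitSlopeSq H x with hJ
  have hJle : ∀ r r', s ≤ r → r ≤ r' →
      J r r' ≤ ENNReal.ofReal (2 * (limitEnergy φ τ w r - limitEnergy φ τ w r')) := by
    intro r r' hr hrr
    rcases hrr.eq_or_lt with rfl | hlt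
    · simp [hJ]
    · exact (h.energy_inequality hσ_dist (hs.trans_le hr) hlt).1
  have hJt : ∀ r r', s ≤ r → r ≤ r' → J r r' ≠ ⊤ := fun r r' hr hrr =>
    ne_top_of_le_ne_top ENNReal.ofReal_ne_top (hJle r r' hr hrr)
  have hψ := h.antitone_limitEnergy
  have hJr : ∀ r r', s ≤ r → r ≤ r' →
      (J r r').toReal ≤ 2 * (limitEnergy φ τ w r - limitEnergy φ τ w r') := fun r r' hr hrr =>
    ENNReal.toReal_le_of_le_ofReal (by linarith [hψ hrr]) (hJle r r' hr hrr)
  have hJadd : ∀ r r', s ≤ r → r ≤ r' → (J s r').toReal = (J s r).toReal + (J r r').toReal := by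
    intro r r' hr hrr
    rw [← ENNReal.toReal_add (hJt s r le_rfl hr) (hJt r r' hr hrr)]
    congr 1
    simp only [hJ]
    rw [← lintegral_union measurableSet_Ioc (Ioc_disjoint_Ioc_of_le le_rfl),
      Ioc_union_Ioc_eq_Ioc hr hrr]
  -- What is left of the energy drop after the dissipation by slope is a monotone function that
  -- controls the squared increments of `u`.
  set k : ℝ → ℝ := fun r => -limitEnergy φ τ w r - (J s r).toReal / 2 with hk
  have hkk : ∀ r r', s ≤ r → r ≤ r' → 2 * (k r' - k r) =
      2 * (limitEnergy φ τ w r - limitEnergy φ τ w r') - (J r r').toReal := by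
    intro r r' hr hrr
    simp only [hk, hJadd r r' hr hrr]
    ring
  have hmono : MonotoneOn k (Icc s t) := fun r hr r' _ hrr => by
    linarith [hkk r r' hr.1 hrr, hJr r r' hr.1 hrr]
  have hkin := lintegral_metricDeriv_sq_le (u := u) hst.le hmono
    (h.intervalIntegrable_limit hs.le (hs.trans hst).le)
    (fun r hr => h.limit_pos r (hs.trans hr.1)) fun r hr r' hr' hrr => by
      rw [hkk r r' hr.1 hrr]
      rcases hrr.eq_or_lt with rfl | hlt
      · simp
      · exact (h.energy_inequality hσ_dist (hs.trans_le hr.1) hlt).2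
  have hslope : ∫⁻ r in Ioo s t, ENNReal.ofReal (l r) * localSlope φlim (u r) ^ 2 ≤ J s t := by
    simp only [hJ]
    rw [← restrict_Ioo_eq_restrict_Ioc]
    refine setLIntegral_mono' measurableSet_Ioo fun r hr => ?_
    gcongr
    exact (h.limit_at hσ_dist (hs.trans hr.1)).1
  have e1 : (1 / 2 : ℝ≥0∞) * J s t = ENNReal.ofReal ((J s t).toReal / 2) := by
    rw [div_eq_inv_mul, ENNReal.ofReal_mul (by norm_num),
      ENNReal.ofReal_toReal (hJt s t le_rfl hst.le), ENNReal.ofReal_inv_of_pos two_pos]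
    simp
  calc _ ≤ ENNReal.ofReal (k t - k s) + (1 / 2) * J s t := by gcongr
    _ = ENNReal.ofReal (limitEnergy φ τ w s - limitEnergy φ τ w t) := by
      have h0 : k s ≤ k t := hmono (left_mem_Icc.2 hst.le) (right_mem_Icc.2 hst.le) hst.le
      rw [e1, ← ENNReal.ofReal_add (by linarith) (by positivity)]
      congr 1
      linarith [hkk s t le_rfl hst.le]

/-- The integral of `l` times the limit slope is finite away from time `0`, and `l` is positive. -/
theorem ae_limitSlopeSq_ne_top
    (hσ_dist : @LowerSemicontinuous (S × S) ℝ (@instTopologicalSpaceProd S S σ σ) _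
      (fun p => dist p.1 p.2))
    (h : ConvergentScheme σ φ φlim a τ w Z H l u p) :
    ∀ᵐ t, 0 < t → limitSlopeSq H t ≠ ⊤ := by
  have : ∀ n : ℕ, ∀ᵐ t, t ∈ Ioc (1 / ((n : ℝ) + 1)) ((n : ℝ) + 2) → limitSlopeSq H t ≠ ⊤ := by
    intro n
    have hn : (0 : ℝ) < 1 / ((n : ℝ) + 1) := by positivity
    have hn' : 1 / ((n : ℝ) + 1) < (n : ℝ) + 2 := by
      rw [div_lt_iff₀ (by positivity)]
      nlinarith [Nat.cast_nonneg (α := ℝ) n]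
    have hfin := ne_top_of_le_ne_top ENNReal.ofReal_ne_top
      (h.energy_inequality hσ_dist hn hn').1
    have hae : AEMeasurable (fun r => ENNReal.ofReal (l r) * limitSlopeSq H r)
        (volume.restrict (Ioc (1 / ((n : ℝ) + 1)) ((n : ℝ) + 2))) :=
      ((intervalIntegrable_iff_integrableOn_Ioc_of_le hn'.le).1
        (h.intervalIntegrable_limit hn.le (hn.trans hn').le)).aemeasurable.ennreal_ofReal.mul
        h.measurable_limitSlopeSq.aemeasurable
    have := (ae_restrict_iff' measurableSet_Ioc).1 (ae_lt_top' hae hfin)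
    filter_upwards [this] with t ht htm hG
    have hlt := ht htm
    rw [hG, ENNReal.mul_top (by simpa using h.limit_pos t (hn.trans htm.1))] at hlt
    exact lt_irrefl _ hlt
  filter_upwards [ae_all_iff.2 this] with t ht ht0
  obtain ⟨n, hn⟩ := exists_nat_gt (max t (1 / t))
  have hn1 := (le_max_left _ _).trans_lt hn
  have hn2 := (le_max_right _ _).trans_lt hn
  refine ht n ⟨?_, by linarith⟩
  rw [div_lt_iff₀ ht0] at hn2
  rw [div_lt_iff₀ (by positivity)]
  nlinarith

/-- The limit energy represents `φlim ∘ u`: the two agree wherever the limit slope is finite and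
the limit energy is continuous. -/
theorem ae_energy_eq
    (hσ_dist : @LowerSemicontinuous (S × S) ℝ (@instTopologicalSpaceProd S S σ σ) _
      (fun p => dist p.1 p.2))
    (h : ConvergentScheme σ φ φlim a τ w Z H l u p) :
    ∀ᵐ t ∂(volume.restrict (Ioi (0 : ℝ))), φlim (u t) = (limitEnergy φ τ w t : EReal) := by
  rw [ae_restrict_iff' measurableSet_Ioi]
  filter_upwards [h.ae_limitSlopeSq_ne_top hσ_dist,
    (h.antitone_limitEnergy.countable_not_continuousAt).ae_notMem volume] with t ht hc ht0
  have ht0' : 0 < t := ht0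
  have hct : ContinuousAt (limitEnergy φ τ w) t := by simpa using hc
  obtain ⟨y, hy, h1, h2⟩ := (h.limit_at hσ_dist ht0').2 (ht ht0')
  rw [hy, EReal.coe_eq_coe_iff]
  refine le_antisymm ?_ ?_
  · refine ge_of_tendsto (hct.tendsto.mono_left (nhdsWithin_le_nhds (s := Iio t))) ?_
    filter_upwards [Ioo_mem_nhdsLT ht0'] with x hx
    obtain ⟨q, hq1, hq2⟩ := exists_rat_btwn hx.2
    exact (h1 q (by exact_mod_cast hx.1.trans hq1) hq2).trans (h.antitone_limitEnergy hq1.le)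
  · refine le_of_tendsto (hct.tendsto.mono_left (nhdsWithin_le_nhds (s := Ioi t))) ?_
    filter_upwards [self_mem_nhdsWithin] with x hx
    obtain ⟨q, hq1, hq2⟩ := exists_rat_btwn (show t < x from hx)
    exact (h.antitone_limitEnergy hq2.le).trans (h2 q hq1)

end ConvergentScheme

end Limit

/-! ### Extraction of a subsequence and conclusion -/

/-- Uniform integrability up to time `0` passes to the weak limit. -/
theorem WeakL1LocConverges.intervalIntegrable_zero {a : ℝ → ℕ → ℝ}
    {l : ℝ → ℝ} (hl : ∀ t, 0 < t → 0 < l t)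
    (hui : ∀ T : ℝ, 0 < T →
      UniformIntegrable (fun (τ : {τ : ℝ // 0 < τ}) (t : ℝ) => 1 / interp a τ t) 1
        (volume.restrict (Icc 0 T)))
    (hw : WeakL1LocConverges (fun τ t => 1 / interp a τ t) l) {T : ℝ} (hT : 0 < T) :
    IntervalIntegrable l volume 0 T := by
  obtain ⟨-, -, C, hC⟩ := hui T hT
  rw [intervalIntegrable_iff_integrableOn_Ioc_of_le hT.le]
  have hs : Tendsto (fun n : ℕ => T / ((n : ℝ) + 2)) atTop (𝓝 0) :=
    tendsto_const_nhds.div_atTop (tendsto_natCast_atTop_atTop.atTop_add tendsto_const_nhds)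
  have hs0 : ∀ n : ℕ, 0 < T / ((n : ℝ) + 2) := fun n => by positivity
  have hsT : ∀ n : ℕ, T / ((n : ℝ) + 2) < T := fun n => div_lt_self hT (by
    linarith [Nat.cast_nonneg (α := ℝ) n])
  refine integrableOn_Ioc_of_intervalIntegral_norm_bounded_left (I := (C : ℝ)) (l := atTop)
    (a := fun n : ℕ => T / ((n : ℝ) + 2)) (fun n => ?_) hs (Eventually.of_forall fun n => ?_)
  · exact (hw _ T (hs0 n) (hsT n)).2.1.mono_set Ioc_subset_Icc_self
  · obtain ⟨-, -, hconv⟩ := hw _ T (hs0 n) (hsT n)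
    have h1 := hconv (fun _ => 1) measurable_const ⟨1, fun _ => by simp⟩
    simp only [one_mul] at h1
    have e : ∫ x in Ioc (T / ((n : ℝ) + 2)) T, ‖l x‖ = ∫ x in Icc (T / ((n : ℝ) + 2)) T, l x := by
      rw [integral_Icc_eq_integral_Ioc]
      refine setIntegral_congr_fun measurableSet_Ioc fun x hx => ?_
      exact Real.norm_of_nonneg (hl x ((hs0 n).trans hx.1)).le
    rw [e]
    refine le_of_tendsto h1 ?_
    filter_upwards [self_mem_nhdsWithin] with τ hτ
    have h2 := hC ⟨τ, hτ⟩
    rw [eLpNorm_one_eq_lintegral_enorm] at h2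
    refine (le_abs_self _).trans ?_
    rw [← Real.norm_eq_abs, ← toReal_enorm]
    refine ENNReal.toReal_le_of_le_ofReal NNReal.zero_le_coe ?_
    rw [ENNReal.ofReal_coe_nnreal]
    refine (enorm_integral_le_lintegral_enorm _).trans (le_trans ?_ h2)
    exact lintegral_mono_set (Icc_subset_Icc_left (hs0 n).le)

/-- A sequence of functions on a countable set that is pointwise bounded has a pointwise convergent
subsequence. -/
theorem exists_subseq_tendsto_of_countable {ι : Type*} [Countable ι] {x : ℕ → ι → ℝ} {R : ι → ℝ}
    (hx : ∀ k i, |x k i| ≤ R i) :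
    ∃ n : ℕ → ℕ, StrictMono n ∧ ∀ i, ∃ c, Tendsto (fun k => x (n k) i) atTop (𝓝 c) := by
  obtain ⟨c, -, n, hn, hc⟩ := (isCompact_univ_pi fun i => isCompact_Icc (a := -R i)
    (b := R i)).tendsto_subseq (x := x) fun k i _ => abs_le.1 (hx k i)
  exact ⟨n, hn, fun i => ⟨c i, (tendsto_pi_nhds.1 hc) i⟩⟩

/-- Every perturbed minimizing movement is the limit of a convergent scheme, after passing to a
subsequence along which the energies converge at all rational times. -/
theorem exists_convergentScheme {S : Type*} [MetricSpace S]
    (σ : TopologicalSpace S)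
    (hσ_dist : @LowerSemicontinuous (S × S) ℝ (@instTopologicalSpaceProd S S σ σ) _
      (fun p => dist p.1 p.2))
    (a : ℝ → ℕ → ℝ) (ha : ∀ τ, 0 < τ → ∀ n, 1 ≤ n → 0 < a τ n)
    (φ : ℝ → S → EReal) (hφ_bot : ∀ ε, 0 < ε → ∀ u, φ ε u ≠ ⊥)
    (φlim : S → EReal) (u₀ : ℝ → ℝ → S) (ustar : S)
    (hassump : ExistenceAssumptions σ φ a u₀ ustar)
    (l : ℝ → ℝ) (hl : ∀ t, 0 < t → 0 < l t)
    (hweak : WeakL1LocConverges (fun τ t => 1 / interp a τ t) l)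
    (hCG : ColomboGobbino σ φ φlim)
    (u : ℝ → S) (hu : IsPerturbedMinimizingMovement σ φ a u₀ u) :
    ∃ (φ' : ℕ → S → EReal) (a' : ℕ → ℕ → ℝ) (τ : ℕ → ℝ) (w : ℕ → ℕ → S) (Z : ℕ → ℝ → S)
      (H : ℕ → ℝ → ℝ), ConvergentScheme σ φ' φlim a' τ w Z H l u ustar := by
  obtain ⟨τ, ε, w, hτ, hε, hτ0, hε0, hdisc, hconv⟩ := hu
  obtain ⟨τm, hτm⟩ := hτ0.bddAbove_range
  have hτm' : ∀ k, τ k ≤ τm := fun k => hτm (mem_range_self k)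
  have hτm0 : 0 < τm := (hτ 0).trans_le (hτm' 0)
  have hbd : ∀ T, ∃ R, ∀ k, ∀ t ≤ T, dist (w k ⌈t / τ k⌉₊) ustar ≤ R ∧
      |(φ (ε k) (w k ⌈t / τ k⌉₊)).toReal| ≤ R := by
    intro T
    obtain ⟨R, hR⟩ := hassump.exists_bounds hφ_bot ha (T := |T| + τm) (by positivity)
    refine ⟨R, fun k t ht => hR (τ k) (ε k) (hτ k) (hε k) (w k) (hdisc k) _ ?_⟩
    rcases le_or_gt t 0 with h0 | h0
    · rw [Nat.ceil_eq_zero.2 (div_nonpos_of_nonpos_of_nonneg h0 (hτ k).le), Nat.cast_zero, zero_mul]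
      positivity
    · have := Nat.ceil_lt_add_one (div_pos h0 (hτ k)).le
      have := mul_lt_mul_of_pos_right this (hτ k)
      rw [add_mul, div_mul_cancel₀ _ (hτ k).ne', one_mul] at this
      linarith [hτm' k, le_abs_self T]
  choose R hR using hbd
  obtain ⟨n, hn, hrat⟩ := exists_subseq_tendsto_of_countable
    (x := fun k (q : ℚ) => (φ (ε k) (w k ⌈(q : ℝ) / τ k⌉₊)).toReal) (R := fun q => R q)
    fun k q => (hR q k q le_rfl).2
  have hinterp : ∀ k, ∃ Z H, IsInterpolation (φ (ε k)) (τ k) (a (τ k)) (w k) Z H := fun k =>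
    (hdisc k).exists_isInterpolation (hφ_bot _ (hε k)) (hτ k) (ha _ (hτ k)) fun m c hc =>
      hassump.exists_isProx hσ_dist (hε k) (hφ_bot _ (hε k)) ((hdisc k).ne_top m) hc
  choose Z H hZ using hinterp
  refine ⟨fun k => φ (ε (n k)), fun k => a (τ (n k)), τ ∘ n, w ∘ n, Z ∘ n, H ∘ n, ?_⟩
  exact
    { bot := fun k => hφ_bot _ (hε _)
      pos_step := fun k => hτ _
      step_tendsto := hτ0.comp hn.tendsto_atTop
      pos_coeff := fun k => ha _ (hτ _)
      disc := fun k => ⟨rfl, (hdisc (n k)).init_dom, (hdisc (n k)).step⟩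
      interpolation := fun k => hZ _
      conv := fun t ht => (hconv t ht).comp hn.tendsto_atTop
      limit_pos := hl
      limit_integrable := fun T hT => hweak.intervalIntegrable_zero hl hassump.unifIntegrable hT
      integrable := fun k T hT => by
        rw [intervalIntegrable_iff_integrableOn_Icc_of_le hT.le]
        exact memLp_one_iff_integrable.1
          ((hassump.unifIntegrable T hT).memLp ⟨τ (n k), hτ _⟩)
      weak := fun s t hs hst g hg hgC => by
        refine ((hweak s t hs hst).2.2 g hg hgC).comp
          (tendsto_nhdsWithin_iff.2 ⟨hτ0.comp hn.tendsto_atTop, Eventually.of_forall fun k => hτ _⟩)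
      bounds := fun T => ⟨R T, fun k t ht => hR T (n k) t ht⟩
      compact := fun r => by
        obtain ⟨K, hK, hmem⟩ := hassump.compact (max r 1) (by positivity)
        exact ⟨K, hK, fun k v h1 h2 => hmem _ (hε _) v (h1.trans_le (le_max_left _ _))
          (h2.trans_le (EReal.coe_le_coe_iff.2 (le_max_left _ _)))⟩
      lower := fun r => by
        obtain ⟨B, hB⟩ := hassump.coercive 1 one_pos
        refine ⟨B - r ^ 2, fun k v hv => ?_⟩
        by_cases hvt : φ (ε (n k)) v = ⊤
        · rw [hvt]; exact le_top
        have h1 := hB _ (hε (n k)) v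
        have h2 : dist v ustar ^ 2 ≤ r ^ 2 := by gcongr
        rw [← EReal.coe_toReal hvt (hφ_bot _ (hε _) v)] at h1 ⊢
        have h3 : B ≤ (φ (ε (n k)) v).toReal + 1 * dist v ustar ^ 2 := by exact_mod_cast h1
        exact EReal.coe_le_coe_iff.2 (by linarith)
      slope_liminf := fun m hm v vlim hv hbound =>
        hCG (fun j => ε (n (m j))) v vlim (fun j => hε _)
          (hε0.comp (hn.tendsto_atTop.comp hm.tendsto_atTop)) hv hbound
      energy_conv := fun q _ => hrat q }

end PerturbedMM

theorem mainTheorem1 {S : Type*} [MetricSpace S] [CompleteSpace S]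
    (σ : TopologicalSpace S) (hσ_T2 : @T2Space S σ)
    (hσ_weaker : (UniformSpace.toTopologicalSpace : TopologicalSpace S) ≤ σ)
    (hσ_dist : @LowerSemicontinuous (S × S) ℝ (@instTopologicalSpaceProd S S σ σ) _
      (fun p => dist p.1 p.2))
    (a : ℝ → ℕ → ℝ) (ha : ∀ τ, 0 < τ → ∀ n, 1 ≤ n → 0 < a τ n)
    (φ : ℝ → S → EReal) (hφ_bot : ∀ ε, 0 < ε → ∀ u, φ ε u ≠ ⊥)
    (hφ_proper : ∀ ε, 0 < ε → ∃ u, φ ε u ≠ ⊤)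
    (φlim : S → EReal) (hφlim_bot : ∀ u, φlim u ≠ ⊥)
    (u₀ : ℝ → ℝ → S) (ustar : S)
    (hassump : PerturbedMM.ExistenceAssumptions σ φ a u₀ ustar)
    (astar : ℝ → ℝ) (hastar_meas : Measurable astar) (hastar_pos : ∀ t, 0 < t → 0 < astar t)
    (hweak : PerturbedMM.WeakL1LocConverges (fun τ t => 1 / PerturbedMM.interp a τ t)
      (fun t => 1 / astar t))
    (hCG : PerturbedMM.ColomboGobbino σ φ φlim)
    (hslope : PerturbedMM.IsStrongUpperGradient φlim (PerturbedMM.localSlope φlim))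
    (u : ℝ → S) (hu : PerturbedMM.IsPerturbedMinimizingMovement σ φ a u₀ u) :
    PerturbedMM.IsCurveOfMaximalSlope φlim (PerturbedMM.localSlope φlim)
      (fun t => 1 / astar t) u := by
  have hrate : ∀ t, 0 < t → 0 < 1 / astar t := fun t ht => one_div_pos.2 (hastar_pos t ht)
  obtain ⟨φ', a', τ, w, Z, H, h⟩ := PerturbedMM.exists_convergentScheme σ hσ_dist a ha φ hφ_bot
    φlim u₀ ustar hassump (fun t => 1 / astar t) hrate hweak hCG u hu
  exact
    { upperGradient := hslope
      rate_measurable := measurable_const.div hastar_meas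
      rate_pos := hrate
      ac := fun T hT => h.isAC hσ_dist hT
      energy := ⟨PerturbedMM.limitEnergy φ' τ w, h.antitone_limitEnergy.antitoneOn _,
        h.ae_energy_eq hσ_dist, fun s t hs hst => h.dissipation_le hσ_dist hs hst⟩ }
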